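/- Let $D\subset\mathbb R^2$ be a bounded open set of class $C^2$ (locally at its boundary, after a rigid change of coordinates, the region above the graph of a $C^2$ function), let $h>0$ and $\Omega=D\times(-h,0)$. Write $\nabla$, $\nabla\cdot$ and $\Delta$ for the (weak) gradient, divergence and Laplacian in the horizontal variables $(x,y)$, write $n$ for the outward unit normal of $\partial D$, and for $u\in(L^2(\Omega))^2$ let $\bar u(x,y)=\frac1h\int_{-h}^0u(x,y,z)\,dz$ be its vertical average. Let $$H_1=\{v\in(L^2(\Omega))^2:\ \nabla\cdot\bar v=0 \text{ in } D,\ \bar v\cdot n|_{\partial D}=0\},$$ $$G_1=\{u\in(L^2(\Omega))^2:\ u_z=0,\ u=\nabla q \text{ for some } q\in H^1(D) \text{ with } \Delta q=0\},$$ $$G_2=\{u\in(L^2(\Omega))^2:\ u_z=0,\ u=\nabla q \text{ for some } q\in H^1_0(D)\}.$$ Here the normal trace $w\cdot n|_{\partial D}\in H^{-1/2}(\partial D)$ of a divergence free field $w\in(L^2(D))^2$ is defined by Green's formula, $\langle w\cdot n,\varphi|_{\partial D}\rangle=\int_D w\cdot\nabla\varphi$ for $\varphi\in H^1(D)$, where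 $H^{1/2}(\partial D)=H^1(D)/H^1_0(D)$ is the space of boundary values of $H^1(D)$ functions. Then $H_1$, $G_1$, $G_2$ are mutually orthogonal in $(L^2(\Omega))^2$ and $$(L^2(\Omega))^2=H_1\oplus G_1\oplus G_2 .$$ Moreover, the orthogonal projection $\mathbb P$ of $(L^2(\Omega))^2$ onto $H_1$ exists, and for every $u\in(L^2(\Omega))^2$ the following holds. The Dirichlet problem $$q_2\in H^1_0(D),\qquad \Delta q_2=\nabla\cdot\bar u \ \text{ in } H^{-1}(D)$$ has a solution. For every solution $q_2$ of it, the field $\bar u-\nabla q_2$ is divergence free and the Neumann problem $$q_1\in H^1(D),\qquad \Delta q_1=0 \text{ in } D,\qquad \partial_n q_1|_{\partial D}=n\cdot(\bar u-\nabla q_2)\ \text{ in } H^{-1/2}(\partial D)$$ has a solution. For every such $q_1$ and $q_2$, $$u=\mathbb P u+\nabla(q_1+q_2)\quad\text{a.e. in }\Omega .$$ -/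

import Mathlib

open MeasureTheory Set Topology
open scoped ContDiff Gradient InnerProductSpace ENNReal

noncomputable section

namespace Hydrostatic

/-! ## The horizontal plane and the cylinder -/

/-- The horizontal plane `ℝ²` with its Euclidean structure. -/
abbrev Plane : Type := EuclideanSpace ℝ (Fin 2)

/-- A set in the plane is of class `C²` at its boundary: near each boundary point, after a
rigid change of the coordinate axes, it is the region strictly above the graph of a `C²`
function of one variable. -/
def HasC2Boundary (D : Set Plane) : Prop :=
  ∀ x ∈ frontier D, ∃ r > 0, ∃ e : Plane ≃ₗᵢ[ℝ] Plane, ∃ γ : ℝ → ℝ, ContDiff ℝ 2 γ ∧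
    D ∩ Metric.ball x r = {y ∈ Metric.ball x r | γ (e y 0) < e y 1}

/-- The cylinder `D × (-h, 0)`, with points written `(x, z)`, `x` horizontal. -/
def cylinder (D : Set Plane) (h : ℝ) : Set (Plane × ℝ) := D ×ˢ Ioo (-h) 0

/-- Lebesgue measure on `D`. -/
abbrev volD (D : Set Plane) : Measure Plane := volume.restrict D

/-- Lebesgue measure on the cylinder. -/
abbrev volΩ (D : Set Plane) (h : ℝ) : Measure (Plane × ℝ) := volume.restrict (cylinder D h)

/-- The scalar space `L²(D)`. -/
abbrev L2D (D : Set Plane) : Type := Lp ℝ 2 (volD D)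

/-- The vector space `(L²(D))²`. -/
abbrev L2DVec (D : Set Plane) : Type := Lp Plane 2 (volD D)

/-- The vector space `(L²(Ω))²` of horizontal fields on the cylinder `Ω`, with its usual
inner product. -/
abbrev L2Ω (D : Set Plane) (h : ℝ) : Type := Lp Plane 2 (volΩ D h)

/-! ## Test functions and Sobolev spaces on `D` -/

/-- `φ ∈ C_c^∞(U)`. -/
def IsTest {E : Type*} [NormedAddCommGroup E] [NormedSpace ℝ E] (U : Set E) (φ : E → ℝ) : Prop :=
  ContDiff ℝ ∞ φ ∧ HasCompactSupport φ ∧ tsupport φ ⊆ U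

theorem IsTest.zero {E : Type*} [NormedAddCommGroup E] [NormedSpace ℝ E] (U : Set E) :
    IsTest U (fun _ : E => (0 : ℝ)) := by
  refine ⟨contDiff_const, HasCompactSupport.zero, ?_⟩
  have : tsupport (fun _ : E => (0 : ℝ)) = ∅ := tsupport_eq_empty_iff.2 rfl
  simp [this]

theorem IsTest.add {E : Type*} [NormedAddCommGroup E] [NormedSpace ℝ E] {U : Set E}
    {φ ψ : E → ℝ} (hφ : IsTest U φ) (hψ : IsTest U ψ) : IsTest U (fun x => φ x + ψ x) :=
  ⟨hφ.1.add hψ.1, hφ.2.1.add hψ.2.1,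
    (tsupport_add φ ψ).trans (union_subset hφ.2.2 hψ.2.2)⟩

theorem IsTest.const_mul {E : Type*} [NormedAddCommGroup E] [NormedSpace ℝ E] {U : Set E}
    {φ : E → ℝ} (c : ℝ) (hφ : IsTest U φ) : IsTest U (fun x => c * φ x) :=
  ⟨contDiff_const.mul hφ.1, hφ.2.1.mul_left,
    (tsupport_mul_subset_right (f := fun _ => c) (g := φ)).trans hφ.2.2⟩

theorem IsTest.memLp {E : Type*} [NormedAddCommGroup E] [NormedSpace ℝ E] [MeasurableSpace E]
    [OpensMeasurableSpace E] [SecondCountableTopology E] {U : Set E} {φ : E → ℝ}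
    (hφ : IsTest U φ) (μ : Measure E) [IsFiniteMeasureOnCompacts μ] : MemLp φ 2 μ :=
  hφ.1.continuous.memLp_of_hasCompactSupport hφ.2.1

theorem IsTest.memLp_gradient {U : Set Plane} {φ : Plane → ℝ} (hφ : IsTest U φ)
    (μ : Measure Plane) [IsFiniteMeasureOnCompacts μ] : MemLp (∇ φ) 2 μ := by
  have hc : Continuous (∇ φ) :=
    (InnerProductSpace.toDual ℝ Plane).symm.continuous.comp
      (hφ.1.continuous_fderiv (by simp))
  exact hc.memLp_of_hasCompactSupport
    ((hφ.2.1.fderiv ℝ).comp_left (map_zero (InnerProductSpace.toDual ℝ Plane).symm))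

theorem IsTest.memLp_dz {U : Set (Plane × ℝ)} {φ : Plane × ℝ → ℝ} (hφ : IsTest U φ)
    (μ : Measure (Plane × ℝ)) [IsFiniteMeasureOnCompacts μ] :
    MemLp (fun p => fderiv ℝ φ p (0, 1)) 2 μ :=
  ((hφ.1.continuous_fderiv (by simp)).clm_apply continuous_const).memLp_of_hasCompactSupport
    (hφ.2.1.fderiv_apply ℝ (0, 1))

theorem integrable_smul_of_memLp {α F : Type*} [MeasurableSpace α] [NormedAddCommGroup F]
    [NormedSpace ℝ F] {μ : Measure α} {f : α → ℝ} {g : α → F} (hf : MemLp f 2 μ)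
    (hg : MemLp g 2 μ) : Integrable (fun x => f x • g x) μ :=
  memLp_one_iff_integrable.1 (hg.smul hf)

/-- `g` is the weak gradient of `f` on `D`. -/
def IsWeakGradient (D : Set Plane) (f : L2D D) (g : L2DVec D) : Prop :=
  ∀ φ : Plane → ℝ, IsTest D φ → ∫ x in D, f x • ∇ φ x = -∫ x in D, φ x • g x

/-- The Sobolev space `H¹(D)`: pairs `(q, ∇q)` of an `L²` function and its weak gradient, also
in `L²`.  The norm inherited from the `ℓ²` product is `(‖q‖² + ‖∇q‖²)^(1/2)`. -/
def H1 (D : Set Plane) : Submodule ℝ (WithLp 2 (L2D D × L2DVec D)) where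
  carrier := {q | IsWeakGradient D q.fst q.snd}
  zero_mem' := by
    intro φ _
    have h1 : ∫ x in D, ((0 : L2D D) x) • ∇ φ x = 0 := by
      refine integral_eq_zero_of_ae ?_
      filter_upwards [Lp.coeFn_zero ℝ 2 (volD D)] with x hx
      rw [hx, Pi.zero_apply, zero_smul, Pi.zero_apply]
    have h2 : ∫ x in D, φ x • ((0 : L2DVec D) x) = 0 := by
      refine integral_eq_zero_of_ae ?_
      filter_upwards [Lp.coeFn_zero Plane 2 (volD D)] with x hx
      simp only [hx, Pi.zero_apply, smul_zero]
    change ∫ x in D, ((0 : L2D D) x) • ∇ φ x = -∫ x in D, φ x • ((0 : L2DVec D) x)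
    rw [h1, h2, neg_zero]
  add_mem' := by
    intro p q hp hq φ hφ
    have h1 : ∫ x in D, ((p.fst + q.fst : L2D D) x) • ∇ φ x
        = (∫ x in D, p.fst x • ∇ φ x) + ∫ x in D, q.fst x • ∇ φ x := by
      rw [← integral_add (integrable_smul_of_memLp (Lp.memLp _) (hφ.memLp_gradient _))
        (integrable_smul_of_memLp (Lp.memLp _) (hφ.memLp_gradient _))]
      refine integral_congr_ae ?_
      filter_upwards [Lp.coeFn_add p.fst q.fst] with x hx
      simp only [hx, Pi.add_apply, add_smul]
    have h2 : ∫ x in D, φ x • ((p.snd + q.snd : L2DVec D) x)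
        = (∫ x in D, φ x • p.snd x) + ∫ x in D, φ x • q.snd x := by
      rw [← integral_add (integrable_smul_of_memLp (hφ.memLp _) (Lp.memLp _))
        (integrable_smul_of_memLp (hφ.memLp _) (Lp.memLp _))]
      refine integral_congr_ae ?_
      filter_upwards [Lp.coeFn_add p.snd q.snd] with x hx
      simp only [hx, Pi.add_apply, smul_add]
    change ∫ x in D, ((p.fst + q.fst : L2D D) x) • ∇ φ x
      = -∫ x in D, φ x • ((p.snd + q.snd : L2DVec D) x)
    rw [h1, h2, hp φ hφ, hq φ hφ, neg_add]
  smul_mem' := by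
    intro c p hp φ hφ
    have h1 : ∫ x in D, ((c • p.fst : L2D D) x) • ∇ φ x = c • ∫ x in D, p.fst x • ∇ φ x := by
      rw [← integral_smul]
      refine integral_congr_ae ?_
      filter_upwards [Lp.coeFn_smul c p.fst] with x hx
      simp [hx, mul_smul]
    have h2 : ∫ x in D, φ x • ((c • p.snd : L2DVec D) x) = c • ∫ x in D, φ x • p.snd x := by
      rw [← integral_smul]
      refine integral_congr_ae ?_
      filter_upwards [Lp.coeFn_smul c p.snd] with x hx
      simp [hx, smul_comm c]
    change ∫ x in D, ((c • p.fst : L2D D) x) • ∇ φ x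
      = -∫ x in D, φ x • ((c • p.snd : L2DVec D) x)
    rw [h1, h2, hp φ hφ, smul_neg]

/-- The weak gradient `∇ : H¹(D) → (L²(D))²`. -/
def grad (D : Set Plane) : H1 D →L[ℝ] L2DVec D :=
  (WithLp.sndL 2 ℝ (L2D D) (L2DVec D)).comp (H1 D).subtypeL

/-- The test functions, as a subspace of `H¹(D)`. -/
def testSubspace (D : Set Plane) : Submodule ℝ (H1 D) where
  carrier := {q | ∃ φ : Plane → ℝ, IsTest D φ ∧ q.1.fst =ᵐ[volD D] φ}
  zero_mem' := ⟨_, IsTest.zero D, Lp.coeFn_zero ℝ 2 (volD D)⟩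
  add_mem' := by
    rintro p q ⟨φ, hφ, hp⟩ ⟨ψ, hψ, hq⟩
    refine ⟨_, hφ.add hψ, (Lp.coeFn_add p.1.fst q.1.fst).trans ?_⟩
    filter_upwards [hp, hq] with x h1 h2
    simp [h1, h2]
  smul_mem' := by
    rintro c p ⟨φ, hφ, hp⟩
    refine ⟨_, hφ.const_mul c, (Lp.coeFn_smul c p.1.fst).trans ?_⟩
    filter_upwards [hp] with x h1
    simp [h1]

/-- `H¹₀(D)`: the closure of `C_c^∞(D)` in `H¹(D)`. -/
def H10 (D : Set Plane) : Submodule ℝ (H1 D) := (testSubspace D).topologicalClosure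

/-- `H⁻¹(D)`, the dual of `H¹₀(D)`. -/
abbrev Hneg1 (D : Set Plane) : Type := StrongDual ℝ (H10 D)

/-- The divergence of a square integrable field, as an element of `H⁻¹(D)`:
`⟨div w, ψ⟩ = -∫_D w · ∇ψ` for `ψ ∈ H¹₀(D)`. -/
def weakDiv (D : Set Plane) : L2DVec D →ₗ[ℝ] Hneg1 D where
  toFun w := -((innerSL ℝ w).comp ((grad D).comp (H10 D).subtypeL))
  map_add' v w := by
    refine ContinuousLinearMap.ext fun ψ => ?_
    change -⟪v + w, grad D ψ⟫_ℝ = -⟪v, grad D ψ⟫_ℝ + -⟪w, grad D ψ⟫_ℝ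
    rw [inner_add_left, neg_add]
  map_smul' c w := by
    refine ContinuousLinearMap.ext fun ψ => ?_
    change -⟪c • w, grad D ψ⟫_ℝ = c • -⟪w, grad D ψ⟫_ℝ
    rw [real_inner_smul_left, smul_neg, smul_eq_mul]

theorem weakDiv_apply (D : Set Plane) (w : L2DVec D) (ψ : H10 D) :
    weakDiv D w ψ = -⟪w, grad D ψ⟫_ℝ := rfl

/-- The Laplacian `Δ q = div ∇q ∈ H⁻¹(D)` of `q ∈ H¹(D)`. -/
def laplacian (D : Set Plane) (q : H1 D) : Hneg1 D := weakDiv D (grad D q)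

/-! ## Normal traces -/

/-- The space `H^{1/2}(∂D)` of boundary values of `H¹(D)` functions: two such functions have the
same boundary values when they differ by an element of `H¹₀(D)`. -/
abbrev Hhalf (D : Set Plane) : Type := H1 D ⧸ H10 D

/-- `H^{-1/2}(∂D)`, the dual of `H^{1/2}(∂D)`. -/
abbrev HnegHalf (D : Set Plane) : Type := StrongDual ℝ (Hhalf D)

/-- The divergence free fields in `(L²(D))²`. -/
def divFree (D : Set Plane) : Submodule ℝ (L2DVec D) := LinearMap.ker (weakDiv D)

theorem inner_grad_eq_zero {D : Set Plane} {w : L2DVec D} (hw : w ∈ divFree D)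
    {ψ : H1 D} (hψ : ψ ∈ H10 D) : ⟪w, grad D ψ⟫_ℝ = 0 := by
  have h := DFunLike.congr_fun (LinearMap.mem_ker.1 hw) (⟨ψ, hψ⟩ : H10 D)
  rw [weakDiv_apply, zero_apply, neg_eq_zero] at h
  exact h

/-- The normal trace `w · n|_{∂D} ∈ H^{-1/2}(∂D)` of a square integrable divergence free field
`w`, defined by Green's formula
`⟨w · n, φ|_{∂D}⟩ = ∫_D w · ∇φ + ∫_D (div w) φ = ∫_D w · ∇φ` for `φ ∈ H¹(D)`, where
`n` is the outward unit normal. -/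
def normalTrace (D : Set Plane) : divFree D →ₗ[ℝ] HnegHalf D where
  toFun w := (H10 D).liftQL ((innerSL ℝ (w : L2DVec D)).comp (grad D)) (by
    intro ψ hψ
    exact inner_grad_eq_zero w.2 hψ)
  map_add' v w := by
    refine ContinuousLinearMap.ext fun φ => ?_
    obtain ⟨φ, rfl⟩ := Submodule.Quotient.mk_surjective _ φ
    exact inner_add_left (v : L2DVec D) (w : L2DVec D) (grad D φ)
  map_smul' c w := by
    refine ContinuousLinearMap.ext fun φ => ?_
    obtain ⟨φ, rfl⟩ := Submodule.Quotient.mk_surjective _ φ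
    exact real_inner_smul_left (w : L2DVec D) (grad D φ) c

/-- The normal trace acts by Green's formula. -/
theorem normalTrace_mk (D : Set Plane) (w : divFree D) (φ : H1 D) :
    normalTrace D w (Submodule.Quotient.mk φ) = ⟪(w : L2DVec D), grad D φ⟫_ℝ := rfl

/-- `q` is a weak solution of the Neumann problem `Δ q = 0` in `D`,
`∂_n q = n · w` on `∂D`, where `w` is a divergence free field. -/
def IsNeumannSolution (D : Set Plane) (w : L2DVec D) (q : H1 D) : Prop :=
  ∃ (hq : grad D q ∈ divFree D) (hw : w ∈ divFree D),
    normalTrace D ⟨grad D q, hq⟩ = normalTrace D ⟨w, hw⟩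

/-! ## The vertical average -/

theorem volΩ_eq_prod (D : Set Plane) (h : ℝ) :
    volΩ D h = (volD D).prod ((volume : Measure ℝ).restrict (Ioo (-h) 0)) := by
  rw [Measure.prod_restrict, ← Measure.volume_eq_prod]; rfl

/-- The vertical average `(1/h) ∫_{-h}^0 u(x, z) dz`, as a function. -/
def avgFun (h : ℝ) (u : Plane × ℝ → Plane) (x : Plane) : Plane :=
  h⁻¹ • ∫ z in Ioo (-h) 0, u (x, z)

theorem avgFun_congr {D : Set Plane} {h : ℝ} {u v : Plane × ℝ → Plane}
    (huv : u =ᵐ[volΩ D h] v) : avgFun h u =ᵐ[volD D] avgFun h v := by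
  rw [volΩ_eq_prod] at huv
  filter_upwards [Measure.ae_ae_of_ae_prod huv] with x hx
  simp only [avgFun]
  rw [integral_congr_ae hx]

theorem lintegral_slice_lt_top {D : Set Plane} {h : ℝ} {u : Plane × ℝ → Plane}
    (hu : MemLp u 2 (volΩ D h)) :
    ∫⁻ x in D, ∫⁻ z in Ioo (-h) 0, ‖u (x, z)‖ₑ ^ (2 : ℝ) < ⊤ := by
  have h1 := hu.1
  have h2 := lintegral_rpow_enorm_lt_top_of_eLpNorm_lt_top (by norm_num) (by norm_num) hu.2
  rw [volΩ_eq_prod] at h1 h2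
  rw [lintegral_prod _ (by fun_prop)] at h2
  simpa using h2

theorem ae_slice_memLp {D : Set Plane} {h : ℝ} {u : Plane × ℝ → Plane}
    (hu : MemLp u 2 (volΩ D h)) :
    ∀ᵐ x ∂(volD D), MemLp (fun z => u (x, z)) 2 (volume.restrict (Ioo (-h) 0)) := by
  have h1 := hu.1
  rw [volΩ_eq_prod] at h1
  have h2 : AEMeasurable (fun x => ∫⁻ z in Ioo (-h) 0, ‖u (x, z)‖ₑ ^ (2 : ℝ)) (volD D) :=
    AEMeasurable.lintegral_prod_right' (f := fun p => ‖u p‖ₑ ^ (2 : ℝ)) (by fun_prop)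
  filter_upwards [h1.prodMk_left, ae_lt_top' h2 (lintegral_slice_lt_top hu).ne] with x hx hx2
  refine ⟨hx, ?_⟩
  rw [eLpNorm_lt_top_iff_lintegral_rpow_enorm_lt_top (by norm_num) (by norm_num)]
  simpa using hx2

theorem memLp_avgFun {D : Set Plane} {h : ℝ} {u : Plane × ℝ → Plane}
    (hu : MemLp u 2 (volΩ D h)) : MemLp (avgFun h u) 2 (volD D) := by
  have h1 := hu.1
  rw [volΩ_eq_prod] at h1
  refine MemLp.const_smul (f := fun x => ∫ z in Ioo (-h) 0, u (x, z))
    ⟨h1.integral_prod_right', ?_⟩ h⁻¹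
  rw [eLpNorm_lt_top_iff_lintegral_rpow_enorm_lt_top (by norm_num) (by norm_num)]
  set ν : Measure ℝ := volume.restrict (Ioo (-h) 0) with hν
  have key : ∀ᵐ x ∂(volD D), ‖∫ z, u (x, z) ∂ν‖ₑ ^ (2 : ℝ)
      ≤ (∫⁻ z, ‖u (x, z)‖ₑ ^ (2 : ℝ) ∂ν) * ν univ := by
    filter_upwards [ae_slice_memLp hu] with x hx
    have e1 : ‖∫ z, u (x, z) ∂ν‖ₑ ≤ eLpNorm (fun z => u (x, z)) 1 ν := by
      rw [eLpNorm_one_eq_lintegral_enorm]; exact enorm_integral_le_lintegral_enorm _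
    have e2 := eLpNorm_le_eLpNorm_mul_rpow_measure_univ (p := 1) (q := 2) (μ := ν)
      (by norm_num) hx.1
    have e3 := ENNReal.rpow_le_rpow (e1.trans e2) (by norm_num : (0 : ℝ) ≤ 2)
    refine e3.trans_eq ?_
    rw [ENNReal.mul_rpow_of_nonneg _ _ (by norm_num), ← ENNReal.rpow_mul,
      eLpNorm_eq_lintegral_rpow_enorm_toReal (by norm_num) (by norm_num), ← ENNReal.rpow_mul]
    norm_num
  simp only [ENNReal.toReal_ofNat]
  refine (lintegral_mono_ae key).trans_lt ?_
  have hfin : ν univ ≠ ⊤ := by simp [hν]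
  rw [lintegral_mul_const' _ _ hfin]
  exact ENNReal.mul_lt_top (lintegral_slice_lt_top hu) hfin.lt_top

/-- The vertical average `u ↦ ū` from `(L²(Ω))²` to `(L²(D))²`. -/
def avg (D : Set Plane) (h : ℝ) : L2Ω D h →ₗ[ℝ] L2DVec D where
  toFun u := (memLp_avgFun (Lp.memLp u)).toLp (avgFun h u)
  map_add' u v := by
    rw [← MemLp.toLp_add]
    refine MemLp.toLp_congr _ _ ((avgFun_congr (Lp.coeFn_add u v)).trans ?_)
    filter_upwards [ae_slice_memLp (Lp.memLp u), ae_slice_memLp (Lp.memLp v)] with x hu hv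
    simp only [avgFun, Pi.add_apply]
    rw [integral_add (hu.integrable (by norm_num)) (hv.integrable (by norm_num)), smul_add]
  map_smul' c u := by
    rw [RingHom.id_apply, ← MemLp.toLp_const_smul]
    refine MemLp.toLp_congr _ _ ((avgFun_congr (Lp.coeFn_smul c u)).trans ?_)
    filter_upwards with x
    simp only [avgFun, Pi.smul_apply]
    rw [integral_smul, smul_comm]

theorem avg_ae_eq (D : Set Plane) (h : ℝ) (u : L2Ω D h) :
    avg D h u =ᵐ[volD D] fun x => h⁻¹ • ∫ z in Ioo (-h) 0, u (x, z) :=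
  MemLp.coeFn_toLp (memLp_avgFun (Lp.memLp u))

/-! ## The three subspaces -/

/-- The space of `v ∈ (L²(Ω))²` with `div v̄ = 0` in `D` and `v̄ · n = 0` on `∂D`. -/
def spaceH (D : Set Plane) (h : ℝ) : Submodule ℝ (L2Ω D h) where
  carrier := {v | ∃ hv : avg D h v ∈ divFree D, normalTrace D ⟨avg D h v, hv⟩ = 0}
  zero_mem' := by
    have h0 : avg D h 0 ∈ divFree D := by rw [map_zero]; exact zero_mem _
    refine ⟨h0, ?_⟩
    have : (⟨avg D h 0, h0⟩ : divFree D) = 0 := Subtype.ext (map_zero _)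
    rw [this, map_zero]
  add_mem' := by
    rintro u v ⟨hu, hu'⟩ ⟨hv, hv'⟩
    have h0 : avg D h (u + v) ∈ divFree D := by rw [map_add]; exact add_mem hu hv
    refine ⟨h0, ?_⟩
    have : (⟨avg D h (u + v), h0⟩ : divFree D) = ⟨avg D h u, hu⟩ + ⟨avg D h v, hv⟩ :=
      Subtype.ext (map_add _ _ _)
    rw [this, map_add, hu', hv', add_zero]
  smul_mem' := by
    rintro c u ⟨hu, hu'⟩
    have h0 : avg D h (c • u) ∈ divFree D := by
      rw [map_smul]; exact Submodule.smul_mem _ c hu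
    refine ⟨h0, ?_⟩
    have : (⟨avg D h (c • u), h0⟩ : divFree D) = c • ⟨avg D h u, hu⟩ :=
      Subtype.ext (map_smul _ _ _)
    rw [this, map_smul, hu', smul_zero]

/-- `u_z = 0` in the sense of distributions on the cylinder. -/
def ZIndependent (D : Set Plane) (h : ℝ) (u : L2Ω D h) : Prop :=
  ∀ φ : Plane × ℝ → ℝ, IsTest (cylinder D h) φ →
    ∫ p in cylinder D h, fderiv ℝ φ p (0, 1) • u p = 0

/-- For a subspace `S` of `H¹(D)`, the space of `u ∈ (L²(Ω))²` with `u_z = 0` and `u = ∇q` for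
some `q ∈ S`. -/
def gradSpace (D : Set Plane) (h : ℝ) (S : Submodule ℝ (H1 D)) : Submodule ℝ (L2Ω D h) where
  carrier := {u | ZIndependent D h u ∧
    ∃ q ∈ S, u =ᵐ[volΩ D h] fun p => grad D q p.1}
  zero_mem' := by
    refine ⟨fun φ _ => integral_eq_zero_of_ae ?_, 0, zero_mem _, ?_⟩
    · filter_upwards [Lp.coeFn_zero Plane 2 (volΩ D h)] with p hp
      simp only [hp, Pi.zero_apply, smul_zero]
    · have h1 : (fun p : Plane × ℝ => grad D 0 p.1) =ᵐ[volΩ D h] fun _ => 0 := by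
        rw [volΩ_eq_prod, map_zero]
        exact Measure.quasiMeasurePreserving_fst.ae_eq_comp (Lp.coeFn_zero Plane 2 (volD D))
      exact (Lp.coeFn_zero Plane 2 (volΩ D h)).trans h1.symm
  add_mem' := by
    rintro u v ⟨hu, p, hp, hup⟩ ⟨hv, q, hq, hvq⟩
    refine ⟨fun φ hφ => ?_, p + q, add_mem hp hq, ?_⟩
    · have h1 : ∫ p in cylinder D h, fderiv ℝ φ p (0, 1) • (u + v : L2Ω D h) p
          = (∫ p in cylinder D h, fderiv ℝ φ p (0, 1) • u p)
            + ∫ p in cylinder D h, fderiv ℝ φ p (0, 1) • v p := by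
        rw [← integral_add (integrable_smul_of_memLp (hφ.memLp_dz _) (Lp.memLp _))
          (integrable_smul_of_memLp (hφ.memLp_dz _) (Lp.memLp _))]
        refine integral_congr_ae ?_
        filter_upwards [Lp.coeFn_add u v] with x hx
        simp only [hx, Pi.add_apply, smul_add]
      rw [h1, hu φ hφ, hv φ hφ, add_zero]
    · have h1 : (fun x : Plane × ℝ => grad D (p + q) x.1) =ᵐ[volΩ D h]
          fun x => grad D p x.1 + grad D q x.1 := by
        rw [volΩ_eq_prod, map_add]
        exact Measure.quasiMeasurePreserving_fst.ae_eq_comp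
          (Lp.coeFn_add (grad D p) (grad D q))
      filter_upwards [Lp.coeFn_add u v, hup, hvq, h1] with x a b c d
      rw [a, d, Pi.add_apply, b, c]
  smul_mem' := by
    rintro c u ⟨hu, p, hp, hup⟩
    refine ⟨fun φ hφ => ?_, c • p, Submodule.smul_mem _ c hp, ?_⟩
    · have h1 : ∫ p in cylinder D h, fderiv ℝ φ p (0, 1) • (c • u : L2Ω D h) p
          = c • ∫ p in cylinder D h, fderiv ℝ φ p (0, 1) • u p := by
        rw [← integral_smul]
        refine integral_congr_ae ?_
        filter_upwards [Lp.coeFn_smul c u] with x hx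
        simp [hx, smul_comm c]
      rw [h1, hu φ hφ, smul_zero]
    · have h1 : (fun x : Plane × ℝ => grad D (c • p) x.1) =ᵐ[volΩ D h]
          fun x => c • grad D p x.1 := by
        rw [volΩ_eq_prod, map_smul]
        exact Measure.quasiMeasurePreserving_fst.ae_eq_comp (Lp.coeFn_smul c (grad D p))
      filter_upwards [Lp.coeFn_smul c u, hup, h1] with x a b d
      rw [a, d, Pi.smul_apply, b]

/-- The harmonic functions in `H¹(D)`. -/
def harmonicH1 (D : Set Plane) : Submodule ℝ (H1 D) where
  carrier := {q | laplacian D q = 0}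
  zero_mem' := by
    change weakDiv D (grad D 0) = 0
    rw [map_zero, map_zero]
  add_mem' := by
    intro p q hp hq
    simp only [mem_ofPred_eq, laplacian] at hp hq ⊢
    rw [map_add, map_add, hp, hq, add_zero]
  smul_mem' := by
    intro c p hp
    simp only [mem_ofPred_eq, laplacian] at hp ⊢
    rw [map_smul, map_smul, hp, smul_zero]

/-- `G₁`: the gradients of harmonic functions in `H¹(D)`. -/
def spaceG1 (D : Set Plane) (h : ℝ) : Submodule ℝ (L2Ω D h) := gradSpace D h (harmonicH1 D)

/-- `G₂`: the gradients of functions in `H¹₀(D)`. -/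
def spaceG2 (D : Set Plane) (h : ℝ) : Submodule ℝ (L2Ω D h) := gradSpace D h (H10 D)

end Hydrostatic

end

namespace Hydrostatic

/-! ## Fields independent of the vertical variable -/

/-! Averaging over the vertical and extending constantly in the vertical are adjoint up to the
factor `h` (`inner_lift`), so everything reduces to the plane. `H₁` consists of the fields whose
average is orthogonal to every gradient of an `H¹(D)` function (`mem_spaceH_iff`); the Dirichlet and
Neumann problems say that a residual is orthogonal to `∇H¹₀(D)`, respectively `∇H¹(D)`. Both are
solved by orthogonal projection in `L²(D)` once these two spaces of gradients are closed
(`decomposition_of_isClosed`).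

Closedness (`isClosed_map_grad`) follows from a Poincaré inequality on a closed subspace of finite
codimension in `H¹(D)`. Duality with test functions bounds translation differences by the gradient
(`norm_translate_sub_le`). Averaging over translations inside a ball gives Poincaré there, at the
cost of one mean-value constraint; near the boundary, a shift into the domain along the graph
direction reduces the estimate to a compact subset of `D`. Compactness of `closure D` leaves
finitely many constraints, so `D` need not be connected. -/

theorem ae_eq_comp_fst {D : Set Plane} {h : ℝ} {F : Type*} {f g : Plane → F}
    (hfg : f =ᵐ[volD D] g) :
    (fun p : Plane × ℝ => f p.1) =ᵐ[volΩ D h] fun p => g p.1 := by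
  rw [volΩ_eq_prod]
  exact Measure.quasiMeasurePreserving_fst.ae_eq_comp hfg

theorem memLp_comp_fst {D : Set Plane} {h : ℝ} {w : Plane → Plane} (hw : MemLp w 2 (volD D)) :
    MemLp (fun p : Plane × ℝ => w p.1) 2 (volΩ D h) := by
  rw [volΩ_eq_prod]
  exact hw.comp_fst _

/-- The field on the cylinder whose value at `(x, z)` is `w x`. -/
noncomputable def lift (D : Set Plane) (h : ℝ) (w : L2DVec D) : L2Ω D h :=
  (memLp_comp_fst (Lp.memLp w)).toLp _

theorem lift_ae_eq (D : Set Plane) (h : ℝ) (w : L2DVec D) :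
    lift D h w =ᵐ[volΩ D h] fun p => w p.1 :=
  MemLp.coeFn_toLp _

theorem integral_Ioo_neg_zero_const {F : Type*} [NormedAddCommGroup F] [NormedSpace ℝ F]
    [CompleteSpace F] {h : ℝ} (hh : 0 < h) (c : F) :
    ∫ _ in Ioo (-h) 0, c = h • c := by
  rw [setIntegral_const]
  congr 1
  simp [measureReal_def, hh.le]

theorem avg_lift {D : Set Plane} {h : ℝ} (hh : 0 < h) (w : L2DVec D) :
    avg D h (lift D h w) = w := by
  refine Lp.ext ((avg_ae_eq D h _).trans ?_)
  refine (avgFun_congr (lift_ae_eq D h w)).trans ?_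
  filter_upwards with x
  change h⁻¹ • ∫ _ in Ioo (-h) 0, w x = w x
  rw [integral_Ioo_neg_zero_const hh, smul_smul, inv_mul_cancel₀ hh.ne', one_smul]

/-- By Fubini, the vertical integral falls on `u` alone because the second factor does not depend on
`z`. -/
theorem inner_lift {D : Set Plane} {h : ℝ} (hh : 0 < h) (u : L2Ω D h) (w : L2DVec D) :
    ⟪u, lift D h w⟫_ℝ = h * ⟪avg D h u, w⟫_ℝ := by
  have hi : Integrable (fun p : Plane × ℝ => ⟪u p, w p.1⟫_ℝ) (volΩ D h) := by
    refine (L2.integrable_inner (𝕜 := ℝ) u (lift D h w)).congr ?_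
    filter_upwards [lift_ae_eq D h w] with p hp
    rw [hp]
  have h1 : ⟪u, lift D h w⟫_ℝ = ∫ p, ⟪u p, w p.1⟫_ℝ ∂(volΩ D h) := by
    rw [L2.inner_def]
    refine integral_congr_ae ?_
    filter_upwards [lift_ae_eq D h w] with p hp
    rw [hp]
  have h2 : ∫ p, ⟪u p, w p.1⟫_ℝ ∂(volΩ D h)
      = ∫ x in D, ∫ z in Ioo (-h) 0, ⟪u (x, z), w x⟫_ℝ := by
    generalize (u : Plane × ℝ → Plane) = u' at hi ⊢
    rw [volΩ_eq_prod] at hi ⊢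
    exact integral_prod _ hi
  rw [h1, h2, L2.inner_def, ← integral_const_mul]
  refine integral_congr_ae ?_
  filter_upwards [avg_ae_eq D h u, ae_slice_memLp (Lp.memLp u)] with x hx hu
  rw [hx, real_inner_smul_left, ← mul_assoc, mul_inv_cancel₀ hh.ne', one_mul,
    real_inner_comm, ← integral_inner (hu.integrable (by norm_num))]
  simp only [real_inner_comm]

/-- Each vertical slice of `φ` is compactly supported inside the open interval, so its derivative
has integral zero. -/
theorem integral_dz_eq_zero {D : Set Plane} {h : ℝ} {φ : Plane × ℝ → ℝ}
    (hφ : IsTest (cylinder D h) φ) (x : Plane) :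
    ∫ z in Ioo (-h) 0, fderiv ℝ φ (x, z) (0, 1) = 0 := by
  have hd : ∀ z, HasDerivAt (fun z => φ (x, z)) (fderiv ℝ φ (x, z) (0, 1)) z := fun z =>
    ((hφ.1.differentiable (by simp)) (x, z)).hasFDerivAt.comp_hasDerivAt z
      ((hasDerivAt_const z x).prodMk (hasDerivAt_id z))
  have hz : ∀ z, z ∉ Ioo (-h) 0 → (x, z) ∉ tsupport φ := fun z hz hm => hz (hφ.2.2 hm).2
  rw [setIntegral_eq_integral_of_forall_compl_eq_zero fun z hzz => by
    have : fderiv ℝ φ (x, z) = 0 := by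
      by_contra hne
      exact hz z hzz (support_fderiv_subset ℝ hne)
    simp [this]]
  have hcs : HasCompactSupport fun z => φ (x, z) := by
    refine HasCompactSupport.of_support_subset_isCompact (isCompact_Icc (a := -h) (b := 0)) ?_
    intro z hzs
    by_contra hzi
    exact hz z (fun hm => hzi (Ioo_subset_Icc_self hm)) (subset_tsupport _ hzs)
  have hc1 : ContDiff ℝ 1 fun z => φ (x, z) :=
    (hφ.1.comp (contDiff_const.prodMk contDiff_id)).of_le (by simp)
  have hder : deriv (fun z => φ (x, z)) = fun z => fderiv ℝ φ (x, z) (0, 1) :=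
    funext fun z => (hd z).deriv
  rw [← hder]
  exact integral_eq_zero_of_hasDerivAt_of_integrable (fun z => by rw [hder]; exact hd z)
    ((hc1.continuous_deriv le_rfl).integrable_of_hasCompactSupport hcs.deriv)
    (hc1.continuous.integrable_of_hasCompactSupport hcs)

theorem zIndependent_lift (D : Set Plane) (h : ℝ) (w : L2DVec D) :
    ZIndependent D h (lift D h w) := by
  intro φ hφ
  have h1 : ∫ p in cylinder D h, fderiv ℝ φ p (0, 1) • lift D h w p
      = ∫ p in cylinder D h, fderiv ℝ φ p (0, 1) • w p.1 := by
    refine integral_congr_ae ?_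
    filter_upwards [lift_ae_eq D h w] with p hp
    rw [hp]
  have hi : Integrable (fun p : Plane × ℝ => fderiv ℝ φ p (0, 1) • w p.1) (volΩ D h) :=
    integrable_smul_of_memLp (hφ.memLp_dz _) (memLp_comp_fst (Lp.memLp w))
  change _ = ∫ p, fderiv ℝ φ p (0, 1) • w p.1 ∂(volΩ D h) at h1
  rw [volΩ_eq_prod] at hi
  rw [h1, volΩ_eq_prod, integral_prod _ hi]
  refine integral_eq_zero_of_ae (Filter.Eventually.of_forall fun x => ?_)
  simp only [Pi.zero_apply]
  rw [integral_smul_const, integral_dz_eq_zero hφ, zero_smul]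

/-! ### Weak conditions as orthogonality to gradients -/

/-- The condition `u_z = 0` is automatic for a field that is a.e. a horizontal gradient, by
`zIndependent_lift`. -/
theorem mem_gradSpace_iff {D : Set Plane} {h : ℝ} {S : Submodule ℝ (H1 D)} {u : L2Ω D h} :
    u ∈ gradSpace D h S ↔ ∃ q ∈ S, u = lift D h (grad D q) := by
  constructor
  · rintro ⟨-, q, hq, hu⟩
    exact ⟨q, hq, Lp.ext (hu.trans (lift_ae_eq D h _).symm)⟩
  · rintro ⟨q, hq, rfl⟩
    exact ⟨zIndependent_lift D h _, q, hq, lift_ae_eq D h _⟩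

theorem mem_divFree_iff {D : Set Plane} {w : L2DVec D} :
    w ∈ divFree D ↔ ∀ ψ ∈ H10 D, ⟪w, grad D ψ⟫_ℝ = 0 := by
  refine ⟨fun hw ψ hψ => inner_grad_eq_zero hw hψ, fun hw => ?_⟩
  refine LinearMap.mem_ker.2 (ContinuousLinearMap.ext fun ψ => ?_)
  rw [weakDiv_apply, hw ψ ψ.2, neg_zero, zero_apply]

theorem normalTrace_eq_iff {D : Set Plane} (v w : divFree D) :
    normalTrace D v = normalTrace D w ↔
      ∀ φ : H1 D, ⟪(v : L2DVec D), grad D φ⟫_ℝ = ⟪(w : L2DVec D), grad D φ⟫_ℝ := by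
  constructor
  · intro hvw φ
    rw [← normalTrace_mk, hvw, normalTrace_mk]
  · intro hvw
    refine ContinuousLinearMap.ext fun φ => ?_
    obtain ⟨φ, rfl⟩ := Submodule.Quotient.mk_surjective _ φ
    rw [normalTrace_mk, normalTrace_mk, hvw]

/-- Testing against `H10 D` expresses the vanishing divergence; testing against all of `H1 D` adds
the vanishing normal trace. -/
theorem mem_spaceH_iff {D : Set Plane} {h : ℝ} {v : L2Ω D h} :
    v ∈ spaceH D h ↔ ∀ φ : H1 D, ⟪avg D h v, grad D φ⟫_ℝ = 0 := by
  constructor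
  · rintro ⟨hv, hv0⟩ φ
    rw [← normalTrace_mk D ⟨_, hv⟩, hv0, zero_apply]
  · intro hv
    refine ⟨mem_divFree_iff.2 fun ψ _ => hv ψ, ?_⟩
    rw [← map_zero (normalTrace D), normalTrace_eq_iff]
    intro φ
    rw [hv φ, ZeroMemClass.coe_zero, inner_zero_left]

theorem laplacian_eq_weakDiv_iff {D : Set Plane} {q : H1 D} {w : L2DVec D} :
    laplacian D q = weakDiv D w ↔ w - grad D q ∈ divFree D := by
  rw [divFree, LinearMap.mem_ker, map_sub, sub_eq_zero, laplacian, eq_comm]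

/-- Harmonicity of `q` needs no separate clause: it is the case of test functions in `H10 D`, since
`w` is already divergence free. -/
theorem isNeumannSolution_iff {D : Set Plane} {w : L2DVec D} {q : H1 D} (hw : w ∈ divFree D) :
    IsNeumannSolution D w q ↔ ∀ φ : H1 D, ⟪w - grad D q, grad D φ⟫_ℝ = 0 := by
  constructor
  · rintro ⟨hq, hw, h⟩ φ
    rw [inner_sub_left, sub_eq_zero]
    exact ((normalTrace_eq_iff _ _).1 h φ).symm
  · intro h
    have hq : grad D q ∈ divFree D := by
      have : w - grad D q ∈ divFree D := mem_divFree_iff.2 fun ψ _ => h ψ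
      simpa using sub_mem hw this
    refine ⟨hq, hw, (normalTrace_eq_iff _ _).2 fun φ => ?_⟩
    have := h φ
    rw [inner_sub_left, sub_eq_zero] at this
    exact this.symm

/-! ### Orthogonality and the decomposition -/

theorem spaceH_isOrtho_gradSpace {D : Set Plane} {h : ℝ} (hh : 0 < h) (S : Submodule ℝ (H1 D)) :
    spaceH D h ⟂ gradSpace D h S := by
  rw [Submodule.isOrtho_iff_inner_eq]
  intro u hu v hv
  obtain ⟨q, -, rfl⟩ := mem_gradSpace_iff.1 hv
  rw [inner_lift hh, mem_spaceH_iff.1 hu, mul_zero]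

theorem spaceG1_isOrtho_spaceG2 {D : Set Plane} {h : ℝ} (hh : 0 < h) :
    spaceG1 D h ⟂ spaceG2 D h := by
  rw [Submodule.isOrtho_iff_inner_eq]
  intro u hu v hv
  obtain ⟨p, hp, rfl⟩ := mem_gradSpace_iff.1 hu
  obtain ⟨q, hq, rfl⟩ := mem_gradSpace_iff.1 hv
  rw [inner_lift hh, avg_lift hh, inner_grad_eq_zero (LinearMap.mem_ker.2 hp) hq, mul_zero]

theorem sub_lift_mem_spaceH {D : Set Plane} {h : ℝ} (hh : 0 < h) {u : L2Ω D h} {q : H1 D}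
    (hq : ∀ φ : H1 D, ⟪avg D h u - grad D q, grad D φ⟫_ℝ = 0) :
    u - lift D h (grad D q) ∈ spaceH D h := by
  rw [mem_spaceH_iff]
  intro φ
  rw [map_sub, avg_lift hh, hq]

theorem lift_mem_orthogonal {D : Set Plane} {h : ℝ} (hh : 0 < h) (q : H1 D) :
    lift D h (grad D q) ∈ (spaceH D h)ᗮ :=
  (spaceH_isOrtho_gradSpace hh ⊤).symm
    (mem_gradSpace_iff.2 ⟨q, Submodule.mem_top, rfl⟩)

theorem lift_add (D : Set Plane) (h : ℝ) (v w : L2DVec D) :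
    lift D h (v + w) = lift D h v + lift D h w := by
  refine Lp.ext ((lift_ae_eq D h _).trans ?_)
  filter_upwards [ae_eq_comp_fst (h := h) (Lp.coeFn_add v w), lift_ae_eq D h v, lift_ae_eq D h w,
    Lp.coeFn_add (lift D h v) (lift D h w)] with p h1 h2 h3 h4
  rw [h4, Pi.add_apply, h2, h3, h1, Pi.add_apply]

/-- Projection of `w` onto the closed space `∇S`. The choice `S = H10 D` solves the Dirichlet
problem, `S = ⊤` the Neumann problem. -/
theorem exists_grad_of_isClosed {D : Set Plane} (S : Submodule ℝ (H1 D))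
    (hS : IsClosed ((S.map (grad D).toLinearMap : Submodule ℝ (L2DVec D)) : Set (L2DVec D)))
    (w : L2DVec D) : ∃ q ∈ S, ∀ φ ∈ S, ⟪w - grad D q, grad D φ⟫_ℝ = 0 := by
  have : CompleteSpace (S.map (grad D).toLinearMap) := hS.completeSpace_coe
  obtain ⟨v, ⟨q, hq, rfl⟩, hv⟩ :=
    Submodule.HasOrthogonalProjection.exists_orthogonal (K := S.map (grad D).toLinearMap) w
  refine ⟨q, hq, fun φ hφ => ?_⟩
  exact (Submodule.mem_orthogonal' _ _).1 hv _ ⟨φ, hφ, rfl⟩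

/-- The decomposition theorem follows from closedness of the two spaces of gradients. -/
theorem decomposition_of_isClosed {D : Set Plane} {h : ℝ} (hh : 0 < h)
    (h1 : IsClosed (((⊤ : Submodule ℝ (H1 D)).map (grad D).toLinearMap :
      Submodule ℝ (L2DVec D)) : Set (L2DVec D)))
    (h0 : IsClosed (((H10 D).map (grad D).toLinearMap :
      Submodule ℝ (L2DVec D)) : Set (L2DVec D))) :
    spaceH D h ⊔ spaceG1 D h ⊔ spaceG2 D h = ⊤ ∧
    ∃ _ : (spaceH D h).HasOrthogonalProjection,
      ∀ u : L2Ω D h,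
        (∃ q₂ : H10 D, laplacian D q₂ = weakDiv D (avg D h u)) ∧
        ∀ q₂ : H10 D, laplacian D q₂ = weakDiv D (avg D h u) →
          (∃ q₁ : H1 D, IsNeumannSolution D (avg D h u - grad D q₂) q₁) ∧
          ∀ q₁ : H1 D, IsNeumannSolution D (avg D h u - grad D q₂) q₁ →
            u =ᵐ[volΩ D h] fun p =>
              (spaceH D h).starProjection u p + grad D (q₁ + (q₂ : H1 D)) p.1 := by
  have dirichlet : ∀ u : L2Ω D h,
      ∃ q₂ : H10 D, laplacian D q₂ = weakDiv D (avg D h u) := by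
    intro u
    obtain ⟨q, hq, hq'⟩ := exists_grad_of_isClosed (H10 D) h0 (avg D h u)
    exact ⟨⟨q, hq⟩, laplacian_eq_weakDiv_iff.2 (mem_divFree_iff.2 hq')⟩
  have neumann : ∀ w ∈ divFree D, ∃ q₁ : H1 D, IsNeumannSolution D w q₁ := by
    intro w hw
    obtain ⟨q, -, hq⟩ := exists_grad_of_isClosed ⊤ h1 w
    exact ⟨q, (isNeumannSolution_iff hw).2 fun φ => hq φ Submodule.mem_top⟩
  have mem : ∀ (u : L2Ω D h) (q₂ : H10 D), laplacian D q₂ = weakDiv D (avg D h u) →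
      ∀ q₁ : H1 D, IsNeumannSolution D (avg D h u - grad D q₂) q₁ →
        u - lift D h (grad D (q₁ + (q₂ : H1 D))) ∈ spaceH D h := by
    intro u q₂ hq₂ q₁ hq₁
    refine sub_lift_mem_spaceH hh fun φ => ?_
    rw [map_add, add_comm, ← sub_sub]
    exact (isNeumannSolution_iff (laplacian_eq_weakDiv_iff.1 hq₂)).1 hq₁ φ
  -- The projection is exhibited rather than deduced from closedness of `H₁`: the solved problems
  -- split `u` into an element of `H₁` and one of its orthogonal complement.
  have hproj : (spaceH D h).HasOrthogonalProjection := by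
    refine ⟨fun u => ?_⟩
    obtain ⟨q₂, hq₂⟩ := dirichlet u
    obtain ⟨q₁, hq₁⟩ := neumann _ (laplacian_eq_weakDiv_iff.1 hq₂)
    refine ⟨_, mem u q₂ hq₂ q₁ hq₁, ?_⟩
    rw [sub_sub_cancel]
    exact lift_mem_orthogonal hh _
  refine ⟨?_, hproj, fun u => ⟨dirichlet u, fun q₂ hq₂ =>
    ⟨neumann _ (laplacian_eq_weakDiv_iff.1 hq₂), fun q₁ hq₁ => ?_⟩⟩⟩
  · rw [eq_top_iff]
    intro u _
    obtain ⟨q₂, hq₂⟩ := dirichlet u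
    obtain ⟨q₁, hq₁⟩ := neumann _ (laplacian_eq_weakDiv_iff.1 hq₂)
    have hu : u = (u - lift D h (grad D (q₁ + (q₂ : H1 D)))) + lift D h (grad D q₁)
        + lift D h (grad D (q₂ : H1 D)) := by
      rw [map_add, lift_add]; abel
    rw [hu]
    refine Submodule.add_mem_sup (Submodule.add_mem_sup (mem u q₂ hq₂ q₁ hq₁)
      (mem_gradSpace_iff.2 ⟨q₁, ?_, rfl⟩)) (mem_gradSpace_iff.2 ⟨q₂, q₂.2, rfl⟩)
    exact LinearMap.mem_ker.1 hq₁.1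
  -- Uniqueness of the orthogonal splitting makes the formula valid for every choice of `q₁` and
  -- `q₂`.
  · have hP := Submodule.eq_starProjection_of_mem_orthogonal (mem u q₂ hq₂ q₁ hq₁)
      (by rw [sub_sub_cancel]; exact lift_mem_orthogonal hh _)
    rw [hP]
    filter_upwards [Lp.coeFn_sub u (lift D h (grad D (q₁ + (q₂ : H1 D)))),
      lift_ae_eq D h (grad D (q₁ + (q₂ : H1 D)))] with p hp hp'
    rw [hp, Pi.sub_apply, hp', sub_add_cancel]

end Hydrostatic
namespace Hydrostatic

/-! ## Translation estimate for `H¹` functions -/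

/-- The test functions on an open set separate the points of `L²`, hence control its norm. -/
theorem norm_le_of_forall_test {A : Set Plane} (hA : IsOpen A) (F : L2D A) {M : ℝ} (hM0 : 0 ≤ M)
    (hM : ∀ φ (hφ : IsTest A φ), ∫ x in A, φ x * F x ≤ M * ‖(hφ.memLp (volD A)).toLp φ‖) :
    ‖F‖ ≤ M := by
  let S : Submodule ℝ (L2D A) :=
    { carrier := {f | ∃ φ, IsTest A φ ∧ f =ᵐ[volD A] φ}
      zero_mem' := ⟨_, IsTest.zero A, Lp.coeFn_zero ℝ 2 (volD A)⟩
      add_mem' := by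
        rintro p q ⟨φ, hφ, hp⟩ ⟨ψ, hψ, hq⟩
        exact ⟨_, hφ.add hψ, (Lp.coeFn_add p q).trans (hp.add hq)⟩
      smul_mem' := by
        rintro c p ⟨φ, hφ, hp⟩
        refine ⟨_, hφ.const_mul c, (Lp.coeFn_smul c p).trans ?_⟩
        filter_upwards [hp] with x h1
        simp [h1] }
  -- Density of test functions: an `L²` function orthogonal to all of them vanishes a.e. by the
  -- fundamental lemma of the calculus of variations.
  have hS : S.topologicalClosure = ⊤ := by
    rw [Submodule.topologicalClosure_eq_top_iff, Submodule.eq_bot_iff]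
    intro f hf
    have hloc : LocallyIntegrableOn f A volume :=
      LocallyIntegrableOn.mono_set (s := A) (fun x hx => by
        obtain ⟨K, hK, hxK, hKA⟩ := exists_compact_subset hA hx
        refine ⟨K, mem_nhdsWithin_of_mem_nhds (mem_interior_iff_mem_nhds.1 hxK), ?_⟩
        have h2 : MemLp f 2 (volume.restrict K) :=
          (Lp.memLp f).mono_measure (Measure.restrict_mono_set _ hKA)
        have : IsFiniteMeasure (volume.restrict K) := ⟨by simpa using hK.measure_lt_top⟩
        exact h2.integrable (by norm_num)) subset_rfl
    have h0 := hA.ae_eq_zero_of_integral_contDiff_smul_eq_zero hloc fun φ h1 h2 h3 => by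
      have hφ : IsTest A φ := ⟨h1, h2, h3⟩
      have := (Submodule.mem_orthogonal _ _).1 hf ((hφ.memLp (volD A)).toLp φ)
        ⟨φ, hφ, MemLp.coeFn_toLp _⟩
      rw [L2.inner_def] at this
      rw [← this, ← setIntegral_eq_integral_of_forall_compl_eq_zero (s := A)]
      · refine integral_congr_ae ?_
        filter_upwards [(hφ.memLp (volD A)).coeFn_toLp] with x hx
        rw [hx, smul_eq_mul]
        simp [mul_comm]
      · intro x hx
        rw [image_eq_zero_of_notMem_tsupport fun hm => hx (h3 hm), zero_smul]
    refine Lp.ext ?_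
    rw [← ae_restrict_iff' hA.measurableSet] at h0
    exact Filter.EventuallyEq.trans h0 (Lp.coeFn_zero ℝ 2 (volD A)).symm
  have hcl : IsClosed {f : L2D A | ⟪f, F⟫_ℝ ≤ M * ‖f‖} :=
    isClosed_le (by fun_prop) (by fun_prop)
  have hsub : (S : Set (L2D A)) ⊆ {f : L2D A | ⟪f, F⟫_ℝ ≤ M * ‖f‖} := by
    rintro f ⟨φ, hφ, hf⟩
    have hfe : f = (hφ.memLp (volD A)).toLp φ := Lp.ext (hf.trans (MemLp.coeFn_toLp _).symm)
    refine le_trans (le_of_eq ?_) ((hM φ hφ).trans_eq (by rw [hfe]))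
    rw [L2.inner_def]
    refine integral_congr_ae ?_
    filter_upwards [hf] with x hx
    rw [hx]
    simp [mul_comm]
  have hF : F ∈ S.topologicalClosure := by rw [hS]; trivial
  -- By density, `F` itself may serve as the test function.
  have h1 : ⟪F, F⟫_ℝ ≤ M * ‖F‖ := hcl.closure_subset_iff.2 hsub hF
  rw [real_inner_self_eq_norm_sq, sq] at h1
  rcases (norm_nonneg F).eq_or_lt with h0 | h0
  · rwa [← h0]
  · exact le_of_mul_le_mul_right h1 h0


theorem IsTest.comp_sub {A D : Set Plane} {φ : Plane → ℝ} (hφ : IsTest A φ) (w : Plane)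
    (hAD : ∀ x ∈ A, x + w ∈ D) : IsTest D fun y => φ (y - w) := by
  have he : (fun y => φ (y - w)) = φ ∘ Homeomorph.subRight w := rfl
  refine ⟨hφ.1.comp (contDiff_id.sub contDiff_const), ?_, ?_⟩
  · rw [he]; exact hφ.2.1.comp_homeomorph _
  · rw [he, tsupport_comp_eq_preimage]
    intro y hy
    simpa using hAD _ (hφ.2.2 hy)

theorem eLpNorm_test_comp_sub {A D : Set Plane} {φ : Plane → ℝ} (hφ : IsTest A φ) (w : Plane)
    (hAD : ∀ x ∈ A, x + w ∈ D) :
    eLpNorm (fun y => φ (y - w)) 2 (volD D) = eLpNorm φ 2 (volD A) := by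
  rw [eLpNorm_restrict_eq_of_support_subset
      ((subset_tsupport _).trans (hφ.comp_sub w hAD).2.2),
    eLpNorm_restrict_eq_of_support_subset ((subset_tsupport _).trans hφ.2.2)]
  exact eLpNorm_comp_measurePreserving hφ.1.continuous.aestronglyMeasurable
    (measurePreserving_sub_right volume w)

theorem isFiniteMeasure_volD {D : Set Plane} (hDb : Bornology.IsBounded D) :
    IsFiniteMeasure (volD D) := ⟨by simpa using hDb.measure_lt_top⟩

theorem gradient_comp_sub {φ : Plane → ℝ} (w y : Plane) :
    ∇ (fun y => φ (y - w)) y = ∇ φ (y - w) := by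
  simp only [gradient]
  rw [fderiv_comp_sub]

/-- Derivative of the pairing of an `H¹` function with a translated test function. -/
theorem hasDerivAt_integral_translate {D : Set Plane} (hDb : Bornology.IsBounded D) (q : L2D D)
    {φ : Plane → ℝ} (h1 : ContDiff ℝ ∞ φ) (h2 : HasCompactSupport φ) (w : Plane) (s : ℝ) :
    HasDerivAt (fun s : ℝ => ∫ y in D, q y * φ (y - s • w))
      (∫ y in D, q y * -⟪∇ φ (y - s • w), w⟫_ℝ) s := by
  have := isFiniteMeasure_volD hDb
  have hq : Integrable q (volD D) := (Lp.memLp q).integrable (by norm_num)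
  have hd : Continuous (∇ φ) :=
    (InnerProductSpace.toDual ℝ Plane).symm.continuous.comp (h1.continuous_fderiv (by simp))
  obtain ⟨C, hC⟩ := ((h2.fderiv ℝ).comp_left
    (map_zero (InnerProductSpace.toDual ℝ Plane).symm)).exists_bound_of_continuous hd
  obtain ⟨C', hC'⟩ := h2.exists_bound_of_continuous h1.continuous
  have hm : ∀ s : ℝ, AEStronglyMeasurable (fun y => φ (y - s • w)) (volD D) := fun s =>
    (h1.continuous.comp (continuous_id.sub continuous_const)).aestronglyMeasurable
  -- The dominating function is integrable because `D` is bounded, so `q ∈ L²(D) ⊆ L¹(D)`; `C` is a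
  -- global bound for `∇ φ`.
  refine (hasDerivAt_integral_of_dominated_loc_of_deriv_le
    (F' := fun s y => q y * -⟪∇ φ (y - s • w), w⟫_ℝ)
    (bound := fun y => |q y| * (C * ‖w‖)) (s := univ) Filter.univ_mem ?_ ?_ ?_ ?_ ?_ ?_).2
  · exact Filter.Eventually.of_forall fun s => hq.1.mul (hm s)
  · exact hq.mul_bdd (hm s) (Filter.Eventually.of_forall fun y => hC' _)
  · refine hq.1.mul (Continuous.aestronglyMeasurable ?_)
    exact ((hd.comp (continuous_id.sub continuous_const)).inner continuous_const).neg
  · refine Filter.Eventually.of_forall fun y s _ => ?_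
    rw [norm_mul, norm_neg, Real.norm_eq_abs (q y)]
    gcongr
    exact (norm_inner_le_norm _ _).trans (by gcongr; exact hC _)
  · exact hq.abs.mul_const _
  · refine Filter.Eventually.of_forall fun y s _ => HasDerivAt.const_mul _ ?_
    have h3 : HasDerivAt (fun s : ℝ => y - s • w) (-w) s := by
      simpa using ((hasDerivAt_id s).smul_const w).const_sub y
    have h4 := ((h1.differentiable (by simp)) (y - s • w)).hasFDerivAt.comp_hasDerivAt s h3
    rw [map_neg, ← inner_gradient_left] at h4
    exact h4

/-- The weak gradient identity tested against `φ` in the direction `w`. -/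
theorem integral_mul_inner_gradient {D : Set Plane} (q : H1 D) {φ : Plane → ℝ}
    (hφ : IsTest D φ) (w : Plane) :
    ∫ y in D, q.1.fst y * ⟪∇ φ y, w⟫_ℝ = -∫ y in D, φ y * ⟪grad D q y, w⟫_ℝ := by
  have h := congrArg (fun v => ⟪w, v⟫_ℝ) (q.2 φ hφ)
  simp only [inner_neg_right] at h
  rw [← integral_inner (integrable_smul_of_memLp (Lp.memLp _) (hφ.memLp_gradient _)),
    ← integral_inner (integrable_smul_of_memLp (hφ.memLp _) (Lp.memLp _))] at h
  simp only [real_inner_smul_right] at h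
  simp only [real_inner_comm w]
  exact h

theorem abs_integral_mul_inner_le {D : Set Plane} (g : L2DVec D) {φ : Plane → ℝ}
    (hφ : MemLp φ 2 (volD D)) (w : Plane) :
    |∫ y in D, φ y * ⟪g y, w⟫_ℝ| ≤ ‖w‖ * ‖hφ.toLp φ‖ * ‖g‖ := by
  have hφw : MemLp (fun y => φ y • w) 2 (volD D) :=
    (ContinuousLinearMap.toSpanSingleton ℝ w).comp_memLp' hφ
  have h1 : ∫ y in D, φ y * ⟪g y, w⟫_ℝ = ⟪hφw.toLp _, g⟫_ℝ := by
    rw [L2.inner_def]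
    refine integral_congr_ae ?_
    filter_upwards [hφw.coeFn_toLp] with y hy
    rw [hy, real_inner_smul_left, real_inner_comm]
  rw [h1]
  refine (abs_real_inner_le_norm _ _).trans ?_
  gcongr
  refine Lp.norm_le_mul_norm_of_ae_le_mul ?_
  filter_upwards [hφw.coeFn_toLp, hφ.coeFn_toLp] with y hy hy'
  rw [hy, hy', norm_smul, mul_comm]

theorem memLp_comp_add {A D : Set Plane} (hD : IsOpen D) {F : Type*} [NormedAddCommGroup F]
    {f : Plane → F} (hf : MemLp f 2 (volD D)) (w : Plane) (hAD : ∀ x ∈ A, x + w ∈ D) :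
    MemLp (fun x => f (x + w)) 2 (volD A) := by
  have hmp := (measurePreserving_add_right (volume : Measure Plane) w).restrict_preimage
    hD.measurableSet
  exact (hf.comp_measurePreserving hmp).mono_measure (Measure.restrict_mono_set _ hAD)

theorem memLp_translate_sub {A D : Set Plane} (hD : IsOpen D) {f : Plane → ℝ}
    (hf : MemLp f 2 (volD D)) (w : Plane) (hAD0 : A ⊆ D) (hAD : ∀ x ∈ A, x + w ∈ D) :
    MemLp (fun x => f (x + w) - f x) 2 (volD A) :=
  (memLp_comp_add hD hf w hAD).sub (hf.mono_measure (Measure.restrict_mono_set _ hAD0))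

theorem setIntegral_mul_comp_sub {A D : Set Plane} {φ : Plane → ℝ} (hφ : IsTest A φ) (w : Plane)
    (hAD : ∀ x ∈ A, x + w ∈ D) (f : Plane → ℝ) :
    ∫ y in D, f y * φ (y - w) = ∫ x in A, f (x + w) * φ x := by
  rw [setIntegral_eq_integral_of_forall_compl_eq_zero,
    setIntegral_eq_integral_of_forall_compl_eq_zero,
    ← integral_add_right_eq_self _ w]
  · simp
  · intro x hx
    rw [image_eq_zero_of_notMem_tsupport fun hm => hx (hφ.2.2 hm), mul_zero]
  · intro x hx
    rw [image_eq_zero_of_notMem_tsupport (f := fun y => φ (y - w))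
      fun hm => hx ((hφ.comp_sub w hAD).2.2 hm), mul_zero]

/-- Difference quotients of an `H¹` function are controlled by its gradient. -/
theorem norm_translate_sub_le {A D : Set Plane} (hA : IsOpen A) (hD : IsOpen D)
    (hDb : Bornology.IsBounded D) (q : H1 D) (w : Plane)
    (hAD : ∀ s ∈ Icc (0 : ℝ) 1, ∀ x ∈ A, x + s • w ∈ D)
    (hm : MemLp (fun x => q.1.fst (x + w) - q.1.fst x) 2 (volD A)) :
    ‖hm.toLp _‖ ≤ ‖w‖ * ‖grad D q‖ := by
  have hAD0 : ∀ x ∈ A, x + (0 : Plane) ∈ D := by simpa using hAD 0 (by simp)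
  have hAD1 : ∀ x ∈ A, x + w ∈ D := by simpa using hAD 1 (by simp)
  have hqA : MemLp q.1.fst 2 (volD A) :=
    (Lp.memLp q.1.fst).mono_measure
      (Measure.restrict_mono_set _ (fun x hx => by simpa using hAD0 x hx))
  refine norm_le_of_forall_test hA _ (by positivity) fun φ hφ => ?_
  -- The translation is moved onto the test function and varied along the segment from `0` to `w`.
  -- The hypothesis on `A` keeps each translate a test function on `D`, where the weak gradient can
  -- be used.
  have hder := fun s : ℝ => hasDerivAt_integral_translate hDb q.1.fst hφ.1 hφ.2.1 w s
  have hbound : ∀ s ∈ Ico (0 : ℝ) 1, ‖∫ y in D, q.1.fst y * -⟪∇ φ (y - s • w), w⟫_ℝ‖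
      ≤ ‖w‖ * ‖grad D q‖ * ‖(hφ.memLp (volD A)).toLp φ‖ := by
    intro s hs
    have ht := hφ.comp_sub (s • w) (hAD s (Ico_subset_Icc_self hs))
    have h1 := integral_mul_inner_gradient q ht w
    simp only [gradient_comp_sub] at h1
    simp only [mul_neg, integral_neg, h1, neg_neg, Real.norm_eq_abs]
    refine (abs_integral_mul_inner_le (grad D q) (ht.memLp _) w).trans_eq ?_
    rw [Lp.norm_toLp, Lp.norm_toLp,
      eLpNorm_test_comp_sub hφ (s • w) (hAD s (Ico_subset_Icc_self hs))]
    ring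
  have hmv := norm_image_sub_le_of_norm_deriv_le_segment_01'
    (fun s _ => (hder s).hasDerivWithinAt) hbound
  refine le_trans ?_ hmv
  refine le_trans (le_of_eq ?_) (Real.le_norm_self _)
  simp only [one_smul, zero_smul]
  rw [setIntegral_mul_comp_sub hφ w hAD1, setIntegral_mul_comp_sub hφ 0 hAD0, ← integral_sub]
  · refine integral_congr_ae ?_
    filter_upwards [hm.coeFn_toLp] with x hx
    rw [hx, add_zero]; ring
  · exact (memLp_comp_add hD (Lp.memLp q.1.fst) w hAD1).integrable_mul (hφ.memLp _)
  · simp only [add_zero]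
    exact hqA.integrable_mul (hφ.memLp (volD A))

theorem norm_toLp_sq {A : Set Plane} {f : Plane → ℝ} (hf : MemLp f 2 (volD A)) :
    ‖hf.toLp f‖ ^ 2 = ∫ x in A, f x ^ 2 := by
  rw [← real_inner_self_eq_norm_sq, L2.inner_def]
  refine integral_congr_ae ?_
  filter_upwards [hf.coeFn_toLp] with x hx
  rw [hx]
  simp [sq]

theorem integral_translate_sub_sq_le {A D : Set Plane} (hA : IsOpen A) (hD : IsOpen D)
    (hDb : Bornology.IsBounded D) (q : H1 D) (w : Plane)
    (hAD : ∀ s ∈ Icc (0 : ℝ) 1, ∀ x ∈ A, x + s • w ∈ D) :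
    ∫ x in A, (q.1.fst (x + w) - q.1.fst x) ^ 2 ≤ ‖w‖ ^ 2 * ‖grad D q‖ ^ 2 := by
  have hm := memLp_translate_sub (A := A) hD (Lp.memLp q.1.fst) w
    (by simpa [subset_def] using hAD 0 (by simp)) (by simpa using hAD 1 (by simp))
  rw [← norm_toLp_sq hm, ← mul_pow]
  exact pow_le_pow_left₀ (norm_nonneg _) (norm_translate_sub_le hA hD hDb q w hAD hm) 2

end Hydrostatic
namespace Hydrostatic

/-! ## Local Poincaré inequalities -/

theorem integrableOn_sq {D S : Set Plane} (f : L2D D) (hS : S ⊆ D) :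
    IntegrableOn (fun x => f x ^ 2) S :=
  ((Lp.memLp f).mono_measure (Measure.restrict_mono_set _ hS)).integrable_sq

/-- Expanding the square gives a variance identity: for a mean-zero function, the double integral of
squared differences is the squared `L²` norm times twice the total mass. -/
theorem integral_integral_sub_sq {X : Type*} [MeasurableSpace X] {μ : Measure X}
    [IsFiniteMeasure μ] {f : X → ℝ} (hf : MemLp f 2 μ) :
    ∫ y, ∫ x, (f x - f y) ^ 2 ∂μ ∂μ
      = 2 * (μ.real univ * ∫ x, f x ^ 2 ∂μ) - 2 * (∫ x, f x ∂μ) ^ 2 := by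
  have h1 : Integrable f μ := hf.integrable (by norm_num)
  have h2 : Integrable (fun x => f x ^ 2) μ := hf.integrable_sq
  have h3 : ∀ y, ∫ x, (f x - f y) ^ 2 ∂μ
      = (∫ x, f x ^ 2 ∂μ) - (2 * ∫ x, f x ∂μ) * f y + μ.real univ * f y ^ 2 := by
    intro y
    have : ∀ x, (f x - f y) ^ 2 = f x ^ 2 - (2 * f y) * f x + f y ^ 2 := fun x => by ring
    simp_rw [this]
    have h4 : Integrable (fun x => f x ^ 2 - (2 * f y) * f x) μ := h2.sub (h1.const_mul _)
    rw [integral_add h4 (integrable_const _), integral_sub h2 (h1.const_mul _),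
      integral_const_mul, integral_const, smul_eq_mul]
    ring
  simp_rw [h3]
  have h5 : Integrable (fun y => (∫ x, f x ^ 2 ∂μ) - (2 * ∫ x, f x ∂μ) * f y) μ :=
    (integrable_const _).sub (h1.const_mul _)
  rw [integral_add h5 (h2.const_mul _), integral_sub (integrable_const _) (h1.const_mul _),
      integral_const_mul, integral_const,
    integral_const_mul, smul_eq_mul]
  ring

/-- Averaging the translation estimate over a ball. -/
theorem integral_integral_ball_le {D : Set Plane} (hD : IsOpen D)
    (hDb : Bornology.IsBounded D) (q : H1 D) {x₀ : Plane} {ρ : ℝ}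
    (hB : Metric.ball x₀ ρ ⊆ D) :
    ∫ y in Metric.ball x₀ ρ, ∫ x in Metric.ball x₀ ρ, (q.1.fst x - q.1.fst y) ^ 2
      ≤ volume.real (Metric.ball (0 : Plane) (2 * ρ)) * ((2 * ρ) ^ 2 * ‖grad D q‖ ^ 2) := by
  set B := Metric.ball x₀ ρ with hBdef
  set f := q.1.fst with hf
  have hBm : MeasurableSet B := measurableSet_ball
  have hfin : IsFiniteMeasure (volume.restrict B) := isFiniteMeasure_volD (Metric.isBounded_ball)
  have hfB : MemLp f 2 (volume.restrict B) :=
    (Lp.memLp f).mono_measure (Measure.restrict_mono_set _ hB)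
  -- Extension by zero off `B ×ˢ B` allows the substitution `x = y + w` on the whole plane.
  set G : Plane × Plane → ℝ := (B ×ˢ B).indicator fun p => (f p.2 - f p.1) ^ 2 with hG
  have hGi : Integrable G (volume.prod volume) := by
    rw [hG, integrable_indicator_iff (hBm.prod hBm), IntegrableOn, ← Measure.prod_restrict]
    exact ((hfB.comp_snd _).sub (hfB.comp_fst _)).integrable_sq
  have hmp := measurePreserving_prod_add (volume : Measure Plane) (volume : Measure Plane)
  have hGi' : Integrable (fun p : Plane × Plane => G (p.1, p.1 + p.2)) (volume.prod volume) :=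
    hmp.integrable_comp_of_integrable hGi
  have h1 : ∫ y in B, ∫ x in B, (f x - f y) ^ 2 = ∫ y, ∫ x, G (y, x) := by
    rw [← integral_indicator hBm]
    refine integral_congr_ae (Filter.Eventually.of_forall fun y => ?_)
    by_cases hy : y ∈ B
    · simp only [indicator_of_mem hy]
      rw [← integral_indicator hBm]
      refine integral_congr_ae (Filter.Eventually.of_forall fun x => ?_)
      by_cases hx : x ∈ B <;> simp [hG, hx, hy]
    · simp [hG, hy]
  have h2 : ∀ y, ∫ x, G (y, x) = ∫ w, G (y, y + w) := fun y =>
    (integral_add_left_eq_self (fun x => G (y, x)) y).symm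
  rw [h1]
  simp_rw [h2]
  rw [integral_integral_swap hGi']
  -- Two points of the ball differ by less than `2 * ρ`, so longer shifts contribute nothing. For
  -- the others, convexity of the ball keeps the segment from `y` to `y + w` inside it.
  have h3 : ∀ w, ∫ y, G (y, y + w)
      ≤ (Metric.ball (0 : Plane) (2 * ρ)).indicator (fun _ => (2 * ρ) ^ 2 * ‖grad D q‖ ^ 2) w := by
    intro w
    by_cases hw : w ∈ Metric.ball (0 : Plane) (2 * ρ)
    · rw [indicator_of_mem hw]
      set A : Set Plane := B ∩ (fun y => y + w) ⁻¹' B with hA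
      have hAo : IsOpen A :=
        Metric.isOpen_ball.inter (Metric.isOpen_ball.preimage (continuous_add_const w))
      have h4 : ∫ y, G (y, y + w) = ∫ y in A, (f (y + w) - f y) ^ 2 := by
        rw [← integral_indicator hAo.measurableSet]
        refine integral_congr_ae (Filter.Eventually.of_forall fun y => ?_)
        by_cases hy : y ∈ B <;> by_cases hy' : y + w ∈ B <;> simp [hG, hA, hy, hy']
      rw [h4]
      refine (integral_translate_sub_sq_le hAo hD hDb q w fun s hs x hx => hB ?_).trans ?_
      · have := (convex_ball x₀ ρ).add_smul_sub_mem hx.1 hx.2 hs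
        rwa [add_sub_cancel_left] at this
      · gcongr
        exact (mem_ball_zero_iff.1 hw).le
    · rw [indicator_of_notMem hw]
      refine le_of_eq (integral_eq_zero_of_ae (Filter.Eventually.of_forall fun y => ?_))
      refine indicator_of_notMem ?_ _
      rintro ⟨hy, hyw⟩
      refine hw ?_
      rw [mem_ball_zero_iff]
      have h5 : dist (y + w) y < 2 * ρ := by
        have h6 : dist (y + w) x₀ < ρ := hyw
        have h7 : dist y x₀ < ρ := hy
        linarith [dist_triangle_right (y + w) y x₀]
      simpa using h5
  have hfin2 : volume (Metric.ball (0 : Plane) (2 * ρ)) ≠ ⊤ := measure_ball_lt_top.ne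
  refine (integral_mono hGi'.integral_prod_right ?_ h3).trans_eq ?_
  · exact (integrable_indicator_iff measurableSet_ball).2 (integrableOn_const hfin2)
  · rw [integral_indicator measurableSet_ball, setIntegral_const, smul_eq_mul]

/-- Poincaré inequality on a ball, for functions with vanishing mean. -/
theorem exists_integral_ball_sq_le {D : Set Plane} (hD : IsOpen D)
    (hDb : Bornology.IsBounded D) {x₀ : Plane} {ρ : ℝ} (hρ : 0 < ρ)
    (hB : Metric.ball x₀ ρ ⊆ D) :
    ∃ C : ℝ, ∀ q : H1 D, ∫ x in Metric.ball x₀ ρ, q.1.fst x = 0 →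
      ∫ x in Metric.ball x₀ ρ, q.1.fst x ^ 2 ≤ C * ‖grad D q‖ ^ 2 := by
  have hfin : IsFiniteMeasure (volume.restrict (Metric.ball x₀ ρ)) :=
    isFiniteMeasure_volD (Metric.isBounded_ball)
  have hpos : 0 < volume.real (Metric.ball x₀ ρ) :=
    ENNReal.toReal_pos (Metric.measure_ball_pos _ _ hρ).ne' measure_ball_lt_top.ne
  refine ⟨volume.real (Metric.ball (0 : Plane) (2 * ρ)) * (2 * ρ) ^ 2
    / (2 * volume.real (Metric.ball x₀ ρ)), fun q hq => ?_⟩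
  have h1 := integral_integral_ball_le hD hDb q hB
  rw [integral_integral_sub_sq ((Lp.memLp q.1.fst).mono_measure (Measure.restrict_mono_set _ hB)),
    hq, measureReal_restrict_apply_univ] at h1
  rw [div_mul_eq_mul_div, le_div_iff₀ (by positivity)]
  linarith

/-- Near a point of the graph boundary, the `L²` norm is controlled by the gradient and the `L²`
norm on a compact part of the domain. -/
theorem exists_integral_boundary_sq_le {D : Set Plane} (hD : IsOpen D)
    (hDb : Bornology.IsBounded D) (hD2 : HasC2Boundary D) {x₀ : Plane} (hx₀ : x₀ ∈ frontier D) :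
    ∃ δ > 0, ∃ K ⊆ D, IsCompact K ∧ ∃ C : ℝ, ∀ q : H1 D,
      ∫ x in Metric.ball x₀ δ ∩ D, q.1.fst x ^ 2
        ≤ 2 * (∫ x in K, q.1.fst x ^ 2) + C * ‖grad D q‖ ^ 2 := by
  obtain ⟨r, hr, e, γ, hγ, hDr⟩ := hD2 x₀ hx₀
  -- A point within `t` of `x₀`, shifted by at most `t`, stays within `2 * t < r`, where the graph
  -- description of `D` holds.
  set t := r / 3 with ht
  have ht0 : 0 < t := by positivity
  -- In the rotated coordinates this is a vertical shift of height `t`, pointing into the domain.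
  set w : Plane := t • e.symm (EuclideanSpace.single 1 1) with hw
  have hwn : ‖w‖ = t := by
    rw [hw, norm_smul, LinearIsometryEquiv.norm_map]
    simp [abs_of_pos ht0]
  have he0 : ∀ (s : ℝ) (x : Plane), e (x + s • w) 0 = e x 0 := by
    intro s x
    simp [hw]
  have he1 : ∀ (s : ℝ) (x : Plane), e (x + s • w) 1 = e x 1 + s * t := by
    intro s x
    simp [hw]
  set A : Set Plane := Metric.ball x₀ t ∩ D with hA
  have hAo : IsOpen A := Metric.isOpen_ball.inter hD
  -- The shift raises points at least `t` above the graph. This non-strict margin makes `K` closed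
  -- while keeping it inside `D`.
  set K : Set Plane := Metric.closedBall x₀ (2 * t) ∩ {y | γ (e y 0) + t ≤ e y 1} with hK
  have hAγ : ∀ x ∈ A, γ (e x 0) < e x 1 := by
    intro x hx
    have : x ∈ D ∩ Metric.ball x₀ r := ⟨hx.2, Metric.ball_subset_ball (by linarith) hx.1⟩
    rw [hDr] at this
    exact this.2
  have hdist : ∀ s ∈ Icc (0 : ℝ) 1, ∀ x ∈ A, dist (x + s • w) x₀ < 2 * t := by
    intro s hs x hx
    have h1 : dist (x + s • w) x ≤ t := by
      rw [dist_self_add_left, norm_smul, hwn, Real.norm_eq_abs, abs_of_nonneg hs.1]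
      nlinarith [hs.2]
    have h2 : dist x x₀ < t := hx.1
    linarith [dist_triangle (x + s • w) x x₀]
  have hAD : ∀ s ∈ Icc (0 : ℝ) 1, ∀ x ∈ A, x + s • w ∈ D := by
    intro s hs x hx
    have : x + s • w ∈ D ∩ Metric.ball x₀ r := by
      rw [hDr]
      refine ⟨(hdist s hs x hx).trans (by linarith), ?_⟩
      change γ (e (x + s • w) 0) < e (x + s • w) 1
      rw [he0, he1]
      have := hAγ x hx
      have := mul_nonneg hs.1 ht0.le
      linarith
    exact this.1
  have hAK : A ⊆ (fun x => x + w) ⁻¹' K := by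
    intro x hx
    have h0 := he0 1 x
    have h1 := he1 1 x
    have h2 := hdist 1 (by simp) x hx
    rw [one_smul] at h0 h1 h2
    refine ⟨h2.le, ?_⟩
    change γ (e (x + w) 0) + t ≤ e (x + w) 1
    rw [h0, h1]
    linarith [hAγ x hx]
  have hKD : K ⊆ D := by
    rintro x ⟨hx, hx'⟩
    have : x ∈ D ∩ Metric.ball x₀ r := by
      rw [hDr]
      refine ⟨Metric.closedBall_subset_ball (by linarith) hx, ?_⟩
      change γ (e x 0) + t ≤ e x 1 at hx'
      change γ (e x 0) < e x 1
      linarith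
    exact this.1
  have hcoord : ∀ i, Continuous fun y : Plane => e y i := fun i => by fun_prop
  have hKc : IsCompact K := (isCompact_closedBall _ _).inter_right
    (isClosed_le ((hγ.continuous.comp (hcoord 0)).add continuous_const) (hcoord 1))
  refine ⟨t, ht0, K, hKD, hKc, 2 * t ^ 2, fun q => ?_⟩
  set f := q.1.fst with hf
  have hT := integral_translate_sub_sq_le hAo hD hDb q w hAD
  rw [hwn] at hT
  have hAD0 : A ⊆ D := inter_subset_right
  have hAD1 : ∀ x ∈ A, x + w ∈ D := fun x hx => hKD (hAK hx)
  have hi1 : IntegrableOn (fun x => f (x + w) ^ 2) A :=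
    (memLp_comp_add hD (Lp.memLp f) w hAD1).integrable_sq
  have hi2 : IntegrableOn (fun x => (f (x + w) - f x) ^ 2) A :=
    (memLp_translate_sub hD (Lp.memLp f) w hAD0 hAD1).integrable_sq
  have hmp := measurePreserving_add_right (volume : Measure Plane) w
  have hemb : MeasurableEmbedding fun x : Plane => x + w :=
    (MeasurableEquiv.addRight w).measurableEmbedding
  have h1 : ∫ x in A, f (x + w) ^ 2 ≤ ∫ x in K, f x ^ 2 := by
    rw [← hmp.setIntegral_preimage_emb hemb (fun x => f x ^ 2) K]
    refine setIntegral_mono_set ?_ (Filter.Eventually.of_forall fun x => sq_nonneg _)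
      (Filter.Eventually.of_forall hAK)
    exact (hmp.integrableOn_comp_preimage hemb).2 (integrableOn_sq f hKD)
  calc ∫ x in A, f x ^ 2
      ≤ ∫ x in A, (2 * f (x + w) ^ 2 + 2 * (f (x + w) - f x) ^ 2) := by
        refine integral_mono (integrableOn_sq f hAD0) ((hi1.const_mul 2).add (hi2.const_mul 2))
          fun x => ?_
        change f x ^ 2 ≤ 2 * f (x + w) ^ 2 + 2 * (f (x + w) - f x) ^ 2
        -- The difference of the two sides is exactly this square.
        nlinarith [sq_nonneg (2 * f (x + w) - f x)]
    _ = 2 * (∫ x in A, f (x + w) ^ 2) + 2 * ∫ x in A, (f (x + w) - f x) ^ 2 := by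
        rw [integral_add (hi1.const_mul 2) (hi2.const_mul 2), integral_const_mul,
          integral_const_mul]
    _ ≤ 2 * (∫ x in K, f x ^ 2) + 2 * t ^ 2 * ‖grad D q‖ ^ 2 := by
        linarith

end Hydrostatic
-- An abstract closed-image criterion
/-- An operator which is bounded below on a closed subspace of finite codimension maps closed
subspaces to closed subspaces. -/
theorem ContinuousLinearMap.isClosed_map_of_bound_on_cofinite {E F : Type*}
    [NormedAddCommGroup E] [NormedSpace ℝ E] [CompleteSpace E] [NormedAddCommGroup F]
    [NormedSpace ℝ F] (T : E →L[ℝ] F) {N S : Submodule ℝ E} (hN : IsClosed (N : Set E))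
    (hNf : N.CoFG) (hS : IsClosed (S : Set E)) {C : NNReal} (hC : ∀ x ∈ N, ‖x‖ ≤ C * ‖T x‖) :
    IsClosed ((S.map T.toLinearMap : Submodule ℝ F) : Set F) := by
  have hcomp : CompleteSpace (S ⊓ N : Submodule ℝ E) := (hS.inter hN).completeSpace_coe
  have hanti : AntilipschitzWith C (T.comp (S ⊓ N).subtypeL) :=
    ContinuousLinearMap.antilipschitz_of_bound _ fun x => hC x x.2.2
  have hcl := hanti.isClosed_range (T.comp (S ⊓ N).subtypeL).uniformContinuous
  have hfin : (N.comap S.subtype).CoFG := by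
    have : N.comap S.subtype = LinearMap.ker (N.mkQ.comp S.subtype) := by
      rw [LinearMap.ker_comp, Submodule.ker_mkQ]
    rw [this]
    exact Submodule.CoFG.ker _
  have hmap : ((N.comap S.subtype).map (T.toLinearMap.comp S.subtype) : Set F)
      = range (T.comp (S ⊓ N).subtypeL) := by
    ext y
    constructor
    · rintro ⟨x, hx, rfl⟩
      exact ⟨⟨x, x.2, hx⟩, rfl⟩
    · rintro ⟨x, rfl⟩
      exact ⟨⟨x, x.2.1⟩, x.2.2, rfl⟩
  -- The image of `S ⊓ N` is closed because `T` is bounded below there; the image of `S` exceeds it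
  -- by at most finitely many dimensions, which preserves closedness.
  have hrange := LinearMap.isClosed_range_of_isClosed_map_of_finiteDimensional_quotient
    (f := T.toLinearMap.comp S.subtype) (s := N.comap S.subtype) (by rw [hmap]; exact hcl)
  rwa [LinearMap.range_comp, Submodule.range_subtype] at hrange

namespace Hydrostatic

/-! ## Closedness of the space of gradients -/

/-- For each test function and direction the condition equates two continuous functionals on `L²`,
which makes `H1 D` closed, hence complete. -/
theorem isWeakGradient_iff {D : Set Plane} {f : L2D D} {g : L2DVec D} :
    IsWeakGradient D f g ↔ ∀ φ (hφ : IsTest D φ) (w : Plane),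
      ⟪((hφ.memLp_gradient (volD D)).inner_const w).toLp _, f⟫_ℝ
        = -⟪((ContinuousLinearMap.toSpanSingleton ℝ w).comp_memLp'
            (hφ.memLp (volD D))).toLp _, g⟫_ℝ := by
  refine forall₂_congr fun φ hφ => ?_
  have h1 : ∀ w, ⟪((hφ.memLp_gradient (volD D)).inner_const w).toLp _, f⟫_ℝ
      = ⟪w, ∫ x in D, f x • ∇ φ x⟫_ℝ := by
    intro w
    rw [L2.inner_def, ← integral_inner
      (integrable_smul_of_memLp (Lp.memLp _) (hφ.memLp_gradient _))]
    refine integral_congr_ae ?_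
    filter_upwards [((hφ.memLp_gradient (volD D)).inner_const (𝕜 := ℝ) w).coeFn_toLp] with x hx
    rw [hx, real_inner_smul_right, real_inner_comm]
    simp [mul_comm]
  have h2 : ∀ w, ⟪((ContinuousLinearMap.toSpanSingleton ℝ w).comp_memLp'
      (hφ.memLp (volD D))).toLp _, g⟫_ℝ = ⟪w, ∫ x in D, φ x • g x⟫_ℝ := by
    intro w
    rw [L2.inner_def, ← integral_inner (integrable_smul_of_memLp (hφ.memLp _) (Lp.memLp _))]
    refine integral_congr_ae ?_
    filter_upwards [((ContinuousLinearMap.toSpanSingleton ℝ w).comp_memLp'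
      (hφ.memLp (volD D))).coeFn_toLp] with x hx
    rw [hx, real_inner_smul_right]
    simp [real_inner_smul_left]
  simp only [h1, h2, ← inner_neg_right]
  exact ⟨fun h w => by rw [h], fun h => ext_inner_left ℝ h⟩

theorem isClosed_H1 (D : Set Plane) : IsClosed (H1 D : Set (WithLp 2 (L2D D × L2DVec D))) := by
  have : (H1 D : Set (WithLp 2 (L2D D × L2DVec D)))
      = {q | IsWeakGradient D q.fst q.snd} := rfl
  rw [this]
  simp only [isWeakGradient_iff, ofPred_forall]
  refine isClosed_iInter fun φ => isClosed_iInter fun hφ => isClosed_iInter fun w => ?_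
  have hf : Continuous fun q : WithLp 2 (L2D D × L2DVec D) => q.fst :=
    (WithLp.fstL 2 ℝ (L2D D) (L2DVec D)).continuous
  have hg : Continuous fun q : WithLp 2 (L2D D × L2DVec D) => q.snd :=
    (WithLp.sndL 2 ℝ (L2D D) (L2DVec D)).continuous
  exact isClosed_eq (continuous_const.inner hf) (continuous_const.inner hg).neg

instance completeSpace_H1 (D : Set Plane) : CompleteSpace (H1 D) :=
  (isClosed_H1 D).completeSpace_coe

/-! ### Patching the local estimates by compactness -/

/-- On the part of `D` in `S`, the `L²` norm is controlled by the gradient up to finitely many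
continuous linear constraints. -/
def GradControls (D S : Set Plane) : Prop :=
  ∃ N : Submodule ℝ (H1 D), IsClosed (N : Set (H1 D)) ∧ N.CoFG ∧ ∃ C : ℝ, ∀ q ∈ N,
    ∫ x in S ∩ D, q.1.fst x ^ 2 ≤ C * ‖grad D q‖ ^ 2

theorem gradControls_empty (D : Set Plane) : GradControls D ∅ :=
  ⟨⊤, isClosed_univ, Submodule.CoFG.top, 0, fun q _ => by simp⟩

theorem setIntegral_sq_mono {D S T : Set Plane} (f : L2D D) (hST : S ⊆ T) :
    ∫ x in S ∩ D, f x ^ 2 ≤ ∫ x in T ∩ D, f x ^ 2 :=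
  setIntegral_mono_set (integrableOn_sq f inter_subset_right)
    (Filter.Eventually.of_forall fun _ => sq_nonneg _)
    (Filter.Eventually.of_forall (inter_subset_inter_left D hST))

theorem GradControls.mono {D S T : Set Plane} (hST : S ⊆ T) (hT : GradControls D T) :
    GradControls D S := by
  obtain ⟨N, h1, h2, C, hC⟩ := hT
  exact ⟨N, h1, h2, C, fun q hq => (setIntegral_sq_mono q.1.fst hST).trans (hC q hq)⟩

theorem setIntegral_sq_union_le {D S T : Set Plane} (f : L2D D) :
    ∫ x in (S ∪ T) ∩ D, f x ^ 2 ≤ (∫ x in S ∩ D, f x ^ 2) + ∫ x in T ∩ D, f x ^ 2 := by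
  have hi : ∀ U, IntegrableOn (fun x => f x ^ 2) (U ∩ D) := fun U =>
    integrableOn_sq f inter_subset_right
  rw [union_inter_distrib_right]
  rw [← integral_add_measure (hi S) (hi T)]
  exact integral_mono_measure (Measure.restrict_union_le _ _)
    (Filter.Eventually.of_forall fun _ => sq_nonneg _) (Integrable.add_measure (hi S) (hi T))

theorem GradControls.union {D S T : Set Plane} (hS : GradControls D S) (hT : GradControls D T) :
    GradControls D (S ∪ T) := by
  obtain ⟨N, h1, h2, C, hC⟩ := hS
  obtain ⟨N', h1', h2', C', hC'⟩ := hT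
  refine ⟨N ⊓ N', h1.inter h1', h2.inf h2', C + C', fun q hq => ?_⟩
  rw [add_mul]
  exact (setIntegral_sq_union_le q.1.fst).trans (add_le_add (hC q hq.1) (hC' q hq.2))

theorem exists_gradControls_of_mem {D : Set Plane} (hD : IsOpen D)
    (hDb : Bornology.IsBounded D) {x₀ : Plane} (hx₀ : x₀ ∈ D) :
    ∃ U ∈ 𝓝 x₀, GradControls D U := by
  obtain ⟨ρ, hρ, hB⟩ := Metric.isOpen_iff.1 hD x₀ hx₀
  obtain ⟨C, hC⟩ := exists_integral_ball_sq_le hD hDb hρ hB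
  have := isFiniteMeasure_volD hDb
  -- The single constraint is a vanishing integral over the ball, written as a pairing with its
  -- indicator.
  let ℓ : H1 D →L[ℝ] ℝ := (innerSL ℝ (indicatorConstLp 2 (μ := volD D)
    (measurableSet_ball (x := x₀) (ε := ρ)) (measure_ne_top _ _) (1 : ℝ))).comp
      ((WithLp.fstL 2 ℝ (L2D D) (L2DVec D)).comp (H1 D).subtypeL)
  refine ⟨_, Metric.ball_mem_nhds x₀ hρ, LinearMap.ker ℓ.toLinearMap, ℓ.isClosed_ker,
    Submodule.CoFG.ker _, C, fun q hq => ?_⟩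
  have hq' : ⟪indicatorConstLp 2 (μ := volD D) (measurableSet_ball (x := x₀) (ε := ρ))
    (measure_ne_top _ _) (1 : ℝ), q.1.fst⟫_ℝ = 0 := hq
  rw [L2.inner_indicatorConstLp_one, Measure.restrict_restrict measurableSet_ball,
    inter_eq_left.2 hB] at hq'
  rw [inter_eq_left.2 hB]
  exact hC q hq'

theorem gradControls_of_isCompact {D K : Set Plane} (hD : IsOpen D)
    (hDb : Bornology.IsBounded D) (hK : IsCompact K) (hKD : K ⊆ D) : GradControls D K :=
  hK.induction_on (gradControls_empty D) (fun _ _ h => GradControls.mono h)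
    (fun _ _ => GradControls.union) fun x hx => by
      obtain ⟨U, hU, h⟩ := exists_gradControls_of_mem hD hDb (hKD hx)
      exact ⟨U, mem_nhdsWithin_of_mem_nhds hU, h⟩

/-- The boundary estimate adds no constraint beyond those already imposed on the compact set `K`. -/
theorem exists_gradControls_of_mem_frontier {D : Set Plane} (hD : IsOpen D)
    (hDb : Bornology.IsBounded D) (hD2 : HasC2Boundary D) {x₀ : Plane} (hx₀ : x₀ ∈ frontier D) :
    ∃ U ∈ 𝓝 x₀, GradControls D U := by
  obtain ⟨δ, hδ, K, hKD, hK, C, hC⟩ := exists_integral_boundary_sq_le hD hDb hD2 hx₀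
  obtain ⟨N, h1, h2, C', hC'⟩ := gradControls_of_isCompact hD hDb hK hKD
  refine ⟨_, Metric.ball_mem_nhds x₀ hδ, N, h1, h2, 2 * C' + C, fun q hq => ?_⟩
  have h3 := hC' q hq
  rw [inter_eq_left.2 hKD] at h3
  linarith [hC q]

theorem gradControls_closure {D : Set Plane} (hD : IsOpen D)
    (hDb : Bornology.IsBounded D) (hD2 : HasC2Boundary D) : GradControls D (closure D) :=
  hDb.isCompact_closure.induction_on (gradControls_empty D) (fun _ _ h => GradControls.mono h)
    (fun _ _ => GradControls.union) fun x hx => by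
      have : ∃ U ∈ 𝓝 x, GradControls D U := by
        by_cases hxD : x ∈ D
        · exact exists_gradControls_of_mem hD hDb hxD
        · exact exists_gradControls_of_mem_frontier hD hDb hD2
            ⟨hx, by rwa [hD.interior_eq]⟩
      obtain ⟨U, hU, h⟩ := this
      exact ⟨U, mem_nhdsWithin_of_mem_nhds hU, h⟩

theorem norm_sq_eq_integral {D : Set Plane} (f : L2D D) : ‖f‖ ^ 2 = ∫ x in D, f x ^ 2 := by
  rw [← norm_toLp_sq (Lp.memLp f), Lp.toLp_coeFn]

/-- On a bounded open set of class `C²`, the gradients of a closed subspace of `H¹` form a closed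
subspace of `L²`. -/
theorem isClosed_map_grad {D : Set Plane} (hD : IsOpen D) (hDb : Bornology.IsBounded D)
    (hD2 : HasC2Boundary D) {S : Submodule ℝ (H1 D)} (hS : IsClosed (S : Set (H1 D))) :
    IsClosed ((S.map (grad D).toLinearMap : Submodule ℝ (L2DVec D)) : Set (L2DVec D)) := by
  obtain ⟨N, h1, h2, C, hC⟩ := gradControls_closure hD hDb hD2
  -- On `N`, `‖q‖ ^ 2 = ‖q.1.fst‖ ^ 2 + ‖grad D q‖ ^ 2 ≤ (|C| + 1) * ‖grad D q‖ ^ 2`; the absolute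
  -- value is needed because the sign of `C` is not known.
  refine (grad D).isClosed_map_of_bound_on_cofinite h1 h2 hS
    (C := ⟨√(|C| + 1), Real.sqrt_nonneg _⟩) fun q hq => ?_
  have h3 := hC q hq
  rw [inter_eq_right.2 subset_closure, ← norm_sq_eq_integral] at h3
  have h4 : ‖q‖ ^ 2 = ‖q.1.fst‖ ^ 2 + ‖grad D q‖ ^ 2 := WithLp.prod_norm_sq_eq_of_L2 q.1
  change ‖q‖ ≤ √(|C| + 1) * ‖grad D q‖
  refine le_of_sq_le_sq ?_ (by positivity)
  rw [h4, mul_pow, Real.sq_sqrt (by positivity)]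
  nlinarith [le_abs_self C, sq_nonneg ‖grad D q‖]

end Hydrostatic

theorem theorem3p2 (D : Set Hydrostatic.Plane) (hDo : IsOpen D) (hDb : Bornology.IsBounded D)
    (hD2 : Hydrostatic.HasC2Boundary D) (h : ℝ) (hh : 0 < h) :
    Hydrostatic.spaceH D h ⟂ Hydrostatic.spaceG1 D h ∧
    Hydrostatic.spaceH D h ⟂ Hydrostatic.spaceG2 D h ∧
    Hydrostatic.spaceG1 D h ⟂ Hydrostatic.spaceG2 D h ∧
    Hydrostatic.spaceH D h ⊔ Hydrostatic.spaceG1 D h ⊔ Hydrostatic.spaceG2 D h = ⊤ ∧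
    ∃ _ : (Hydrostatic.spaceH D h).HasOrthogonalProjection,
      ∀ u : Hydrostatic.L2Ω D h,
        (∃ q₂ : Hydrostatic.H10 D,
          Hydrostatic.laplacian D q₂ = Hydrostatic.weakDiv D (Hydrostatic.avg D h u)) ∧
        ∀ q₂ : Hydrostatic.H10 D,
          Hydrostatic.laplacian D q₂ = Hydrostatic.weakDiv D (Hydrostatic.avg D h u) →
          (∃ q₁ : Hydrostatic.H1 D, Hydrostatic.IsNeumannSolution D
            (Hydrostatic.avg D h u - Hydrostatic.grad D q₂) q₁) ∧
          ∀ q₁ : Hydrostatic.H1 D, Hydrostatic.IsNeumannSolution D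
            (Hydrostatic.avg D h u - Hydrostatic.grad D q₂) q₁ →
            u =ᵐ[Hydrostatic.volΩ D h] fun p =>
              (Hydrostatic.spaceH D h).starProjection u p
                + Hydrostatic.grad D (q₁ + (q₂ : Hydrostatic.H1 D)) p.1 :=
  ⟨Hydrostatic.spaceH_isOrtho_gradSpace hh _, Hydrostatic.spaceH_isOrtho_gradSpace hh _,
    Hydrostatic.spaceG1_isOrtho_spaceG2 hh,
    Hydrostatic.decomposition_of_isClosed hh
      (Hydrostatic.isClosed_map_grad hDo hDb hD2 isClosed_univ)
      (Hydrostatic.isClosed_map_grad hDo hDb hD2 (Submodule.isClosed_topologicalClosure _))⟩
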